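/- **Setting.** Let $\mathscr A$ be a locally finitely presentable category whose initial object $0$ is simple, i.e. every strong epimorphism with domain $0$ is invertible. Let $U\colon\mathscr A\to\mathbf{Set}$ be a faithful functor which preserves intersections (multiple pullbacks of monomorphisms), is fibre-small (for every set $X$ there is, up to isomorphism, only a set of objects $A$ with $UA=X$) and is uniquely transportable (for every object $A$ and every bijection $b\colon UA\to X$ there is a unique object $B$ with $UB=X$ such that $b$ carries an isomorphism $A\cong B$). Let $H\colon\mathscr A\to\mathscr A$ be an endofunctor preserving intersections. *Subcoalgebras* of a coalgebra $a\colon A\to HA$ are represented by homomorphisms into $(A,a)$ carried by monomorphisms of $\mathscr A$, and *quotients* by homomorphisms out of $(A,a)$ carried by strong epimorphisms of $\mathscr A$; they are proper if not invertible. A coalgebra is *simple* if it has no proper quotient. It is *well-founded* if it has no proper subcoalgebra $m\colon(A',a')\to(A,a)$ for which the square $Hm\cdot a'=a\cdot m$ is a pullback. A *pointed coalgebra* $(A,a,x)$ is a coalgebra $(A,a)$ with an element $x\in UA$; its morphisms are the coalgebra homomorphisms preserving the point. It is *well-pointed* if it has no proper quotient and no proper subobject among pointed coalgebras, these being carried by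 strong epimorphisms and by monomorphisms of $\mathscr A$, respectively. The *well-pointed modification* of $(A,a,x)$ is the least subcoalgebra of the simple quotient $e\colon(A,a)\to(\bar A,\bar a)$ which contains the point $Ue(x)$, pointed by it; it is unique up to isomorphism. Given a set $I$ of representatives of all well-founded, well-pointed coalgebras (precisely one from each isomorphism class), for every well-founded coalgebra $(A,a)$ let $a^+\colon UA\to I$ assign to $x\in UA$ the representative of the well-pointed modification of $(A,a,x)$. **Theorem.** 1. $H$ has an initial algebra if and only if it has, up to isomorphism, only a set of well-founded, well-pointed coalgebras. 2. Every set $I$ of representatives of all well-founded, well-pointed coalgebras carries the initial algebra: there is a coalgebra $\bar\psi\colon\bar I\to H\bar I$ with $U\bar I=I$ such that - for every well-founded coalgebra $(A,a)$ the function $a^+\colon UA\to I$ is well defined and carries a coalgebra homomorphism from $(A,a)$ to $(\bar I,\bar\psi)$; - $\bar\psi$ is canonical: $U\bar\psi(A,a,x)=\bigl(U(Ha^+)\cdot Ua\bigr)(x)$ for every member $(A,a,x)$ of $I$; - $\bar\psi$ is invertible, and $(\bar I,\bar\psi^{-1})$ is an initial algebra for $H$. -/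

import Mathlib

open CategoryTheory CategoryTheory.Limits

universe w v₁ v₂ u₁ u₂ u

namespace WellPointed

/-! ### Notions for a general category -/

/-- A functor preserves (wide) intersections if it preserves all small-indexed multiple pullbacks
of monomorphisms with a common codomain. -/
def PreservesIntersections {C : Type u₁} [Category.{v₁} C] {D : Type u₂} [Category.{v₂} D]
    (F : C ⥤ D) : Prop :=
  ∀ (J : Type w) (B : C) (X : J → C) (m : ∀ j, X j ⟶ B), (∀ j, Mono (m j)) →
    PreservesLimit (WidePullbackShape.wideCospan B X m) F

/-- An object is simple if every strong epimorphism with that domain is invertible. -/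
def IsSimpleObject {C : Type u₁} [Category.{v₁} C] (A : C) : Prop :=
  ∀ ⦃B : C⦄ (e : A ⟶ B), StrongEpi e → IsIso e

/-- A functor to sets is fibre-small if for every set `X` there is, up to isomorphism, only a set
of objects `A` with `U A = X`. -/
def IsFibreSmall {C : Type u₁} [Category.{v₁} C] (U : C ⥤ Type w) : Prop :=
  ∀ X : Type w, ObjectProperty.EssentiallySmall.{w} (fun A : C => U.obj A = X)

/-- A functor to sets is uniquely transportable if for every object `A` and every bijection
`b : U A → X` there is a unique object `B` with `U B = X` for which `b` carries an isomorphism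
from `A` to `B`. -/
def IsUniquelyTransportable {C : Type u₁} [Category.{v₁} C] (U : C ⥤ Type w) : Prop :=
  ∀ (A : C) (X : Type w) (b : U.obj A ≃ X),
    ∃! B : C, ∃ (h : U.obj B = X) (i : A ≅ B), ∀ x : U.obj A, cast h (U.map i.hom x) = b x

/-! ### Coalgebras -/

section Coalgebras

variable {C : Type u} [Category.{w} C] {H : C ⥤ C}

/-- A coalgebra is simple if it has no proper quotient, quotients being represented by the
homomorphisms carried by strong epimorphisms of the base category. -/
def IsSimpleCoalgebra (A : Endofunctor.Coalgebra H) : Prop :=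
  ∀ ⦃B : Endofunctor.Coalgebra H⦄ (e : A ⟶ B), StrongEpi e.f → IsIso e.f

/-- A coalgebra is well-founded if it has no proper cartesian subcoalgebra: every subcoalgebra `m`
(a homomorphism carried by a monomorphism of the base category) whose homomorphism square is a
pullback is invertible. -/
def IsWellFoundedCoalgebra (A : Endofunctor.Coalgebra H) : Prop :=
  ∀ ⦃B : Endofunctor.Coalgebra H⦄ (m : B ⟶ A), Mono m.f →
    IsPullback B.str m.f (H.map m.f) A.str → IsIso m.f

end Coalgebras

/-! ### Pointed coalgebras -/

variable {C : Type u} [Category.{w} C]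

/-- A pointed coalgebra `(A, a, x)`: a coalgebra `a : A ⟶ H A` with an element `x` of `U A`. -/
structure PointedCoalgebra (H : C ⥤ C) (U : C ⥤ Type w) where
  /-- the underlying coalgebra -/
  coalg : Endofunctor.Coalgebra H
  /-- the chosen point -/
  pt : U.obj coalg.V

namespace PointedCoalgebra

variable {H : C ⥤ C} {U : C ⥤ Type w}

/-- Morphisms of pointed coalgebras: the coalgebra homomorphisms preserving the point. -/
@[ext]
structure Hom (P Q : PointedCoalgebra H U) where
  /-- the underlying coalgebra homomorphism -/
  hom : P.coalg ⟶ Q.coalg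
  map_pt : U.map hom.f P.pt = Q.pt

instance : Category (PointedCoalgebra H U) where
  Hom P Q := Hom P Q
  id P := ⟨𝟙 _, by simp⟩
  comp f g := ⟨f.hom ≫ g.hom, by simp [f.map_pt, g.map_pt]⟩

/-- A pointed coalgebra is well-pointed if it has no proper quotient (a morphism out of it carried
by a strong epimorphism) and no proper subobject (a morphism into it carried by a
monomorphism). -/
def IsWellPointed (P : PointedCoalgebra H U) : Prop :=
  (∀ ⦃Q : PointedCoalgebra H U⦄ (e : P ⟶ Q), StrongEpi e.hom.f → IsIso e) ∧
  (∀ ⦃Q : PointedCoalgebra H U⦄ (m : Q ⟶ P), Mono m.hom.f → IsIso m)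

/-- The well-founded, well-pointed coalgebras. -/
def IsWellFoundedWellPointed (P : PointedCoalgebra H U) : Prop :=
  IsWellFoundedCoalgebra P.coalg ∧ P.IsWellPointed

/-- `Q` is (up to isomorphism) the well-pointed modification of `P = (A, a, x)`: for the simple
quotient `e : P ⟶ S` of `P`, pointed by the image of `x`, the pointed coalgebra `Q` is the least
subcoalgebra of `S` containing this point. -/
def IsWellPointedModification (P Q : PointedCoalgebra H U) : Prop :=
  ∃ (S : PointedCoalgebra H U) (e : P ⟶ S) (m : Q ⟶ S),
    (StrongEpi e.hom.f ∧ IsSimpleCoalgebra S.coalg) ∧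
    Mono m.hom.f ∧
    ∀ ⦃Q' : PointedCoalgebra H U⦄ (m' : Q' ⟶ S), Mono m'.hom.f → ∃ k : Q ⟶ Q', k ≫ m' = m

end PointedCoalgebra

open PointedCoalgebra

variable {H : C ⥤ C} {U : C ⥤ Type w} {I : Type w}

/-- The family `R` consists of representatives of the well-founded, well-pointed coalgebras:
precisely one from every isomorphism class. -/
structure IsSetOfRepresentatives (R : I → PointedCoalgebra H U) : Prop where
  mem : ∀ i, (R i).IsWellFoundedWellPointed
  exists_iso : ∀ P : PointedCoalgebra H U, P.IsWellFoundedWellPointed →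
    ∃ i, Nonempty (P ≅ R i)
  eq_of_iso : ∀ i j, Nonempty (R i ≅ R j) → i = j

/-- `g : U A → I` is the function `a⁺`, assigning to every element `x` of `U A` the (index of the)
representative of the well-pointed modification of `(A, a, x)`. -/
def IsPlus (R : I → PointedCoalgebra H U) (A : Endofunctor.Coalgebra H)
    (g : U.obj A.V → I) : Prop :=
  ∀ (x : U.obj A.V) (i : I), IsWellPointedModification ⟨A, x⟩ (R i) ↔ i = g x

/-- The coalgebra `T`, with underlying set equal to `I`, is the canonical coalgebra on the set of
representatives `R`: for every well-founded coalgebra `(A, a)` the function `a⁺` carries a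
coalgebra homomorphism from `(A, a)` to `T`, and the structure of `T` assigns to every member
`(A, a, x)` of `I` the element `U(H a⁺)(U a (x))`. -/
structure IsCanonicalCoalgebra (R : I → PointedCoalgebra H U) (T : Endofunctor.Coalgebra H)
    (hT : U.obj T.V = I) : Prop where
  plus_hom : ∀ A : Endofunctor.Coalgebra H, IsWellFoundedCoalgebra A →
    ∃ h : A ⟶ T, IsPlus R A (fun x => cast hT (U.map h.f x))
  str_apply : ∀ (i : I) (k : (R i).coalg.V ⟶ T.V),
    IsPlus R (R i).coalg (fun x => cast hT (U.map k x)) →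
    U.map T.str (cast hT.symm i) = U.map (H.map k) (U.map (R i).coalg.str (R i).pt)

end WellPointed

/-! The points of the terminal well-founded coalgebra are classified by the well-founded,
well-pointed coalgebras. Every coalgebra has a simple quotient (`exists_simple_quotient`), parallel
homomorphisms into a simple coalgebra agree, and homomorphisms out of one are monic. Two
well-pointed coalgebras that map to the same pointed coalgebra therefore both coincide with their
intersection. Hence each point `y` of a simple well-founded `S` determines exactly one
representative, and distinct points determine distinct ones, so `U S` embeds into `I`.

Fibre-smallness then leaves only a set of simple well-founded coalgebras. The simple quotient `T` of
their coproduct is terminal among the well-founded ones, its points biject with `I`, and transport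
along this bijection gives it the underlying set `I`. The unique homomorphism from a well-founded
`A` to `T` is carried by `a⁺`.

Since `H` sends well-founded coalgebras to well-founded ones, Lambek's argument makes the structure
of `T` invertible. Well-founded coalgebras have unique coalgebra-to-algebra morphisms
(`IsWellFoundedCoalgebra.existsUnique_isSolution`), so the inverse is an initial algebra.
Conversely, an initial algebra receives every well-founded, well-pointed coalgebra by a
monomorphism, and well-poweredness leaves only a set of them. -/

namespace WellPointed

attribute [local instance] Cardinal.fact_isRegular_aleph0

/-! ### Completeness of locally finitely presentable categories -/

section LocallyPresentable

variable {C : Type u} [Category.{w} C]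

/-- A category with small colimits and a small dense full subcategory has small limits, being
reflective in a category of presheaves. -/
theorem hasLimits_of_isDense {S : Type w} [SmallCategory S] [HasColimitsOfSize.{w, w} C]
    (F : S ⥤ C) [F.IsDense] : HasLimitsOfSize.{w, w} C := by
  let L : (Sᵒᵖ ⥤ Type w) ⥤ C := (uliftYoneda.{w}).leftKanExtension F
  have adj : L ⊣ Presheaf.restrictedULiftYoneda.{w} F :=
    Presheaf.uliftYonedaAdjunction L (uliftYoneda.{w}.leftKanExtensionUnit F)
  have : Reflective (Presheaf.restrictedULiftYoneda.{w} F) := { L := L, adj := adj }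
  exact hasLimits_of_reflective (Presheaf.restrictedULiftYoneda.{w} F)

theorem hasLimits_of_isLocallyFinitelyPresentable [IsLocallyFinitelyPresentable.{w} C] :
    HasLimitsOfSize.{w, w} C := by
  have : EssentiallySmall.{w} (isCardinalPresentable C Cardinal.aleph0.{w}).FullSubcategory :=
    inferInstance
  let e := (equivSmallModel.{w}
    (isCardinalPresentable C Cardinal.aleph0.{w}).FullSubcategory).symm.functor
  exact hasLimits_of_isDense (e ⋙ (isCardinalPresentable C Cardinal.aleph0.{w}).ι)

/-- A locally finitely presentable category has a small strong generator of finitely presentable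
objects. -/
theorem exists_finitelyPresentable_strongGenerator [IsLocallyFinitelyPresentable.{w} C] :
    ∃ P : ObjectProperty C, ObjectProperty.Small.{w} P ∧ P.IsStrongGenerator ∧
      ∀ G, P G → IsCardinalPresentable G Cardinal.aleph0.{w} := by
  obtain ⟨P, hP, h⟩ := HasCardinalFilteredGenerator.exists_small_generator C Cardinal.aleph0.{w}
  exact ⟨P, hP, h.isStrongGenerator, fun G hG => h.le_isCardinalPresentable G hG⟩

theorem wellPowered_of_isLocallyFinitelyPresentable [IsLocallyFinitelyPresentable.{w} C] :
    WellPowered.{w} C := by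
  have : HasLimitsOfSize.{w, w} C := hasLimits_of_isLocallyFinitelyPresentable
  have : HasPullbacks C := hasLimitsOfShape_of_essentiallySmall.{w} WalkingCospan C
  obtain ⟨P, hP, h, -⟩ := exists_finitelyPresentable_strongGenerator (C := C)
  refine wellPowered_of_isDetecting (𝒢 := P) ?_
  intro X Y f hf
  have : Mono f := ⟨fun {Z} u v huv => h.isSeparating _ _ fun G hG g => by
    exact (hf G hG (g ≫ u ≫ f)).unique (y₁ := g ≫ u) (by simp) (by simp [huv])⟩
  exact h.isIso_of_mono f fun G hG g => (hf G hG g).exists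

theorem hasPullbacks_of_isLocallyFinitelyPresentable [IsLocallyFinitelyPresentable.{w} C] :
    HasPullbacks C :=
  have : HasLimitsOfSize.{w, w} C := hasLimits_of_isLocallyFinitelyPresentable
  hasLimitsOfShape_of_essentiallySmall.{w} WalkingCospan C

theorem hasEqualizers_of_isLocallyFinitelyPresentable [IsLocallyFinitelyPresentable.{w} C] :
    HasEqualizers C :=
  have : HasLimitsOfSize.{w, w} C := hasLimits_of_isLocallyFinitelyPresentable
  hasLimitsOfShape_of_essentiallySmall.{w} WalkingParallelPair C

end LocallyPresentable

attribute [local instance] hasLimits_of_isLocallyFinitelyPresentable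
  wellPowered_of_isLocallyFinitelyPresentable hasPullbacks_of_isLocallyFinitelyPresentable
  hasEqualizers_of_isLocallyFinitelyPresentable

/-! ### Factorization through monomorphisms -/

section Thru

variable {C : Type u₁} [Category.{v₁} C]

/-- `g` factors through `m`. -/
def Thru {X M A : C} (g : X ⟶ A) (m : M ⟶ A) : Prop := ∃ k, k ≫ m = g

theorem Thru.refl {X A : C} (g : X ⟶ A) : Thru g g := ⟨𝟙 _, by simp⟩

theorem Thru.trans {X M N A : C} {g : X ⟶ A} {m : M ⟶ A} {n : N ⟶ A} (h : Thru g m)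
    (h' : Thru m n) : Thru g n := by
  obtain ⟨k, rfl⟩ := h
  obtain ⟨l, rfl⟩ := h'
  exact ⟨k ≫ l, by simp⟩

theorem Thru.precomp {X Y M A : C} {g : X ⟶ A} {m : M ⟶ A} (h : Thru g m) (f : Y ⟶ X) :
    Thru (f ≫ g) m := by
  obtain ⟨k, rfl⟩ := h
  exact ⟨f ≫ k, by simp⟩

theorem Thru.postcomp {X M A B : C} {g : X ⟶ A} {m : M ⟶ A} (h : Thru g m) (f : A ⟶ B) :
    Thru (g ≫ f) (m ≫ f) := by
  obtain ⟨k, rfl⟩ := h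
  exact ⟨k, by simp⟩

theorem Thru.map {D : Type u₂} [Category.{v₂} D] (F : C ⥤ D) {X M A : C} {g : X ⟶ A} {m : M ⟶ A}
    (h : Thru g m) : Thru (F.map g) (F.map m) := by
  obtain ⟨k, rfl⟩ := h
  exact ⟨F.map k, by simp⟩

theorem thru_of_isIso {X M A : C} (g : X ⟶ A) (m : M ⟶ A) [IsIso m] : Thru g m :=
  ⟨g ≫ inv m, by simp⟩

theorem isIso_of_thru {X M A : C} {g : X ⟶ A} {m : M ⟶ A} [IsIso g] [Mono m] (h : Thru g m) :
    IsIso m := by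
  obtain ⟨k, hk⟩ := h
  exact ⟨inv g ≫ k, by rw [← cancel_mono m]; simp [hk], by simp [hk]⟩

theorem thru_mk_arrow_iff {X M A : C} (g : X ⟶ A) (m : M ⟶ A) [Mono m] :
    Thru g (Subobject.mk m).arrow ↔ Thru g m := by
  refine ⟨fun h => h.trans ⟨(Subobject.underlyingIso m).hom, by simp⟩,
    fun h => h.trans ⟨(Subobject.underlyingIso m).inv, by simp⟩⟩

/-- A map that does not factor through a proper subobject of its codomain is a strong
epimorphism. -/
theorem strongEpi_of_forall_thru [HasPullbacks C] [HasEqualizers C] {A B : C} (e : A ⟶ B)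
    (h : ∀ ⦃M : C⦄ (m : M ⟶ B), Mono m → Thru e m → IsIso m) : StrongEpi e := by
  have : ExtremalEpi e :=
    { left_cancellation := fun f g hfg => by
        have := h (equalizer.ι f g) inferInstance ⟨equalizer.lift e hfg, by simp⟩
        exact eq_of_epi_equalizer
      isIso := fun p i hp _ => h i inferInstance ⟨p, hp⟩ }
  exact (extremalEpi_iff_strongEpi_of_hasPullbacks e).1 this

theorem thru_of_strongEpi {A B M N : C} {e : A ⟶ B} [StrongEpi e] {m : M ⟶ N} [Mono m]
    {g : B ⟶ N} (h : Thru (e ≫ g) m) : Thru g m := by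
  obtain ⟨k, hk⟩ := h
  have sq : CommSq k e m g := ⟨hk⟩
  exact ⟨sq.lift, sq.fac_right⟩

theorem isIso_of_strongEpi_of_thru {A B M : C} {e : A ⟶ B} [StrongEpi e] {m : M ⟶ B} [Mono m]
    (h : Thru e m) : IsIso m :=
  isIso_of_thru (thru_of_strongEpi (g := 𝟙 B) (by simpa using h))

/-- The legs of a colimit cocone do not all factor through a proper subobject. -/
theorem thru_of_isColimit {J : Type u₂} [Category.{v₂} J] {F : J ⥤ C} {c : Cocone F}
    (hc : IsColimit c) {M N : C} (m : M ⟶ N) [Mono m] (g : c.pt ⟶ N)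
    (h : ∀ j, Thru (c.ι.app j ≫ g) m) : Thru g m := by
  choose k hk using h
  refine ⟨hc.desc ⟨M, { app := k, naturality := fun i j f => ?_ }⟩, hc.hom_ext fun j => ?_⟩
  · simp [← cancel_mono m, hk]
  · simp [hk]

end Thru

/-! ### Intersections -/

section Intersections

variable {C : Type u₁} [Category.{v₁} C] {D : Type u₂} [Category.{v₂} D] {F : C ⥤ D}

/-- The monomorphism `n` is the intersection of the family `m` of subobjects. -/
structure IsIntersection {J : Type w} {B W : C} {X : J → C} (m : ∀ j, X j ⟶ B) (n : W ⟶ B) :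
    Prop where
  mono : Mono n
  thru_iff : ∀ ⦃Y : C⦄ (g : Y ⟶ B), Thru g n ↔ ∀ j, Thru g (m j)

theorem exists_isIntersection [HasLimitsOfSize.{w, w} C] {J : Type w} {B : C} {X : J → C}
    (m : ∀ j, X j ⟶ B) (hm : ∀ j, Mono (m j)) :
    ∃ (W : C) (n : W ⟶ B), IsIntersection m n := by
  refine ⟨widePullback B X m, WidePullback.base m, ⟨fun f g h => ?_⟩, fun Y g => ⟨?_, ?_⟩⟩
  · refine WidePullback.hom_ext m _ _ (fun j => ?_) h
    rw [← cancel_mono (m j), Category.assoc, Category.assoc, WidePullback.π_arrow, h]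
  · exact fun h j => h.trans ⟨WidePullback.π m j, by simp⟩
  · intro h
    choose k hk using h
    exact ⟨WidePullback.lift g k hk, WidePullback.lift_base m g k hk⟩

/-- The universal property of `n` is first turned into a limit of the wide cospan, so that `F` may
be applied; the given factorizations then form a cone on the image diagram. -/
theorem PreservesIntersections.map_thru (hF : PreservesIntersections.{w} F) {J : Type w} {B W : C}
    {X : J → C} {m : ∀ j, X j ⟶ B} (hm : ∀ j, Mono (m j)) {n : W ⟶ B} (hn : IsIntersection m n)
    {Y : D} (g : Y ⟶ F.obj B) (hg : ∀ j, Thru g (F.map (m j))) : Thru g (F.map n) := by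
  have := hF J B X m hm
  have := hn.mono
  choose p hp using (hn.thru_iff n).1 (.refl n)
  have key : ∀ t : WidePullbackCone m, ∃ l : t.pt ⟶ W, l ≫ n = t.base := fun t =>
    (hn.thru_iff t.base).2 fun j => ⟨t.π j, t.condition j⟩
  choose l hl using key
  have hc : IsLimit (WidePullbackCone.mk n p hp) := by
    refine WidePullbackCone.IsLimit.mk _ l hl (fun t j => ?_) (fun t f h _ => ?_)
    · have := hm j
      refine (cancel_mono (m j)).1 (((Category.assoc _ _ _).trans ?_).trans (t.condition j).symm)
      exact (congrArg (l t ≫ ·) (hp j)).trans (hl t)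
    · exact (cancel_mono n).1 (h.trans (hl t).symm)
  choose k hk using hg
  let c : Cone (WidePullbackShape.wideCospan B X m ⋙ F) :=
    WidePullbackShape.mkCone (F := WidePullbackShape.wideCospan B X m ⋙ F) g k hk
  exact ⟨(isLimitOfPreserves F hc).lift c, (isLimitOfPreserves F hc).fac c none⟩

/-- A monomorphism is the intersection of two copies of itself, with both projections the identity.
If `u` and `v` agree after `F m`, they are the two legs of one cone on the image, so both equal its
lift. -/
theorem PreservesIntersections.map_mono (hF : PreservesIntersections.{w} F) {A B : C} (m : A ⟶ B)
    [Mono m] : Mono (F.map m) := by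
  have := hF (ULift.{w} Bool) B (fun _ => A) (fun _ => m) (fun _ => inferInstance)
  have hc : IsLimit (WidePullbackCone.mk (f := fun _ : ULift.{w} Bool => m) m (fun _ => 𝟙 A)
      (by simp)) := by
    refine WidePullbackCone.IsLimit.mk _ (fun t => t.π ⟨true⟩) (fun t => t.condition ⟨true⟩)
      (fun t j => ?_) (fun t f h _ => (cancel_mono m).1 (h.trans (t.condition ⟨true⟩).symm))
    exact (Category.comp_id _).trans
      ((cancel_mono m).1 ((t.condition ⟨true⟩).trans (t.condition j).symm))
  refine ⟨fun {Z} u v h => ?_⟩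
  let c : Cone (WidePullbackShape.wideCospan B (fun _ : ULift.{w} Bool => A) (fun _ => m) ⋙ F) :=
    WidePullbackShape.mkCone (F := WidePullbackShape.wideCospan B _ _ ⋙ F) (u ≫ F.map m)
      (fun j => if j.down then u else v) (fun j => by
        change (if j.down then u else v) ≫ F.map m = u ≫ F.map m
        split_ifs
        · rfl
        · exact h.symm)
  have h₁ := (isLimitOfPreserves F hc).fac c (some ⟨true⟩)
  have h₂ := (isLimitOfPreserves F hc).fac c (some ⟨false⟩)
  have e₁ : u = (isLimitOfPreserves F hc).lift c ≫ F.map (𝟙 A) := h₁.symm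
  have e₂ : v = (isLimitOfPreserves F hc).lift c ≫ F.map (𝟙 A) := h₂.symm
  rw [e₁, e₂]

end Intersections

/-! ### Strong epi-mono factorizations -/

section Factorization

variable {C : Type u} [Category.{w} C] [HasLimitsOfSize.{w, w} C] [WellPowered.{w} C]

/-- A class of subobjects has an intersection. -/
theorem exists_intersection_of_subobjects {B : C} (P : Subobject B → Prop) :
    ∃ (W : C) (n : W ⟶ B), Mono n ∧
      (∀ ⦃Y : C⦄ (g : Y ⟶ B), Thru g n ↔ ∀ N : Subobject B, P N → Thru g N.arrow) ∧
      ∃ (J : Type w) (N : J → Subobject B), (∀ j, P (N j)) ∧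
        IsIntersection (fun j => (N j).arrow) n := by
  let e := equivShrink.{w} {N : Subobject B // P N}
  obtain ⟨W, n, hn⟩ := exists_isIntersection
    (fun j : Shrink.{w} {N : Subobject B // P N} => (e.symm j).1.arrow) (fun j => inferInstance)
  refine ⟨W, n, hn.mono, fun Y g => ?_, _, fun j => (e.symm j).1, fun j => (e.symm j).2, hn⟩
  rw [hn.thru_iff]
  refine ⟨fun h N hN => ?_, fun h j => h _ (e.symm j).2⟩
  have := h (e ⟨N, hN⟩)
  rwa [e.symm_apply_apply] at this

/-- The object `M` is the least subobject through which `f` factors. By minimality `e` factors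
through no proper subobject of `M`, hence is a strong epimorphism. -/
theorem exists_strongEpi_mono_factorization {A B : C} (f : A ⟶ B) :
    ∃ (M : C) (e : A ⟶ M) (m : M ⟶ B), StrongEpi e ∧ Mono m ∧ e ≫ m = f := by
  have : HasPullbacks C := hasLimitsOfShape_of_essentiallySmall.{w} WalkingCospan C
  have : HasEqualizers C := hasLimitsOfShape_of_essentiallySmall.{w} WalkingParallelPair C
  obtain ⟨M, m, hm, h, -⟩ := exists_intersection_of_subobjects (fun N => Thru f N.arrow)
  obtain ⟨e, he⟩ := (h f).2 fun N hN => hN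
  refine ⟨M, e, m, strongEpi_of_forall_thru e fun K k hk hek => ?_, hm, he⟩
  have h₁ : Thru m (k ≫ m) := by
    have := (h m).1 (.refl m) (Subobject.mk (k ≫ m))
    simp only [thru_mk_arrow_iff] at this
    exact this (he ▸ hek.postcomp m)
  obtain ⟨l, hl⟩ := h₁
  refine isIso_of_thru (g := 𝟙 M) ⟨l, ?_⟩
  rw [← cancel_mono m]
  simpa using hl

end Factorization

/-! ### Unions of chains of subobjects -/

section LocallyPresentable

variable {C : Type u} [Category.{w} C] [IsLocallyFinitelyPresentable.{w} C]

/-- A colimit of a filtered diagram of subobjects of `A` is a subobject of `A`. -/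
theorem mono_desc_of_isFiltered {J : Type u₁} [Category.{v₁} J] [EssentiallySmall.{w} J]
    [IsFiltered J] {F : J ⥤ C} {c : Cocone F} (hc : IsColimit c) (d : Cocone F)
    (hd : ∀ j, Mono (d.ι.app j)) : Mono (hc.desc d) := by
  obtain ⟨P, -, hP, hG⟩ := exists_finitelyPresentable_strongGenerator (C := C)
  have : IsCardinalFiltered J Cardinal.aleph0.{w} := by
    rwa [isCardinalFiltered_aleph0_iff]
  refine ⟨fun {Z} u v huv => hP.isSeparating _ _ fun G hGP g => ?_⟩
  have := hG G hGP
  -- Maps from the finitely presentable `G` live at some stage of the diagram, and at a common stage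
  -- the leg into the target is monic.
  obtain ⟨i, f, hf⟩ := IsCardinalPresentable.exists_hom_of_isColimit Cardinal.aleph0.{w} hc (g ≫ u)
  obtain ⟨j, f', hf'⟩ :=
    IsCardinalPresentable.exists_hom_of_isColimit Cardinal.aleph0.{w} hc (g ≫ v)
  rw [← hf, ← hf', ← c.w (IsFiltered.leftToMax i j), ← c.w (IsFiltered.rightToMax i j)]
  simp only [← Category.assoc]
  congr 1
  have := hd (IsFiltered.max i j)
  rw [← cancel_mono (d.ι.app (IsFiltered.max i j)), Category.assoc, Category.assoc, d.w, d.w,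
    ← hc.fac d i, ← hc.fac d j, reassoc_of% hf, reassoc_of% hf', huv]

/-- `N` is the union of the chain `c` of subobjects: it is a colimit, and maps from finitely
presentable objects to `N` factor through a member of `c`. -/
structure IsUnion {A : C} (c : Set (Subobject A)) (N : Subobject A) : Prop where
  le : ∀ M ∈ c, M ≤ N
  exists_thru : ∀ ⦃X : C⦄ (g : X ⟶ A), IsCardinalPresentable X Cardinal.aleph0.{w} →
    Thru g N.arrow → ∃ M ∈ c, Thru g M.arrow
  exists_desc : ∀ ⦃B : C⦄ (h : ∀ M : c, (M.1 : C) ⟶ B),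
    (∀ (M M' : c) (hle : M.1 ≤ M'.1), M.1.ofLE M'.1 hle ≫ h M' = h M) →
      ∃ k : (N : C) ⟶ B, ∀ (M : c) (hle : M.1 ≤ N), M.1.ofLE N hle ≫ k = h M
  hom_ext : ∀ ⦃B : C⦄ (k k' : (N : C) ⟶ B),
    (∀ (M : c) (hle : M.1 ≤ N), M.1.ofLE N hle ≫ k = M.1.ofLE N hle ≫ k') → k = k'

/-- The union is the directed colimit of the members of the chain; by `mono_desc_of_isFiltered` it
is again a subobject of `A`. -/
theorem exists_isUnion_of_isChain {A : C} (c : Set (Subobject A)) (hc : IsChain (· ≤ ·) c)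
    (hne : c.Nonempty) : ∃ N : Subobject A, IsUnion c N := by
  have : Nonempty c := hne.to_subtype
  have : IsDirectedOrder c := ⟨fun a b => by
    rcases hc.total a.2 b.2 with h | h
    · exact ⟨b, h, le_rfl⟩
    · exact ⟨a, le_rfl, h⟩⟩
  have : EssentiallySmall.{w} c := inferInstance
  have : IsCardinalFiltered c Cardinal.aleph0.{w} := by
    rw [isCardinalFiltered_aleph0_iff]; infer_instance
  let F : c ⥤ C := (Subtype.mono_coe (· ∈ c)).functor ⋙ Subobject.underlying
  have : HasColimitsOfShape c C := hasColimitsOfShape_of_essentiallySmall.{w} c C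
  obtain ⟨K, ι, m, hm, hιm, hfp, hdesc, hext⟩ :
      ∃ (K : C) (ι : ∀ M : c, (M.1 : C) ⟶ K) (m : K ⟶ A), Mono m ∧ (∀ M, ι M ≫ m = M.1.arrow) ∧
        (∀ (X : C) (g : X ⟶ K), IsCardinalPresentable X Cardinal.aleph0.{w} →
          ∃ M, Thru g (ι M)) ∧
        (∀ ⦃B : C⦄ (h : ∀ M : c, (M.1 : C) ⟶ B),
          (∀ (M M' : c) (hle : M.1 ≤ M'.1), M.1.ofLE M'.1 hle ≫ h M' = h M) →
          ∃ k : K ⟶ B, ∀ M, ι M ≫ k = h M) ∧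
        (∀ ⦃B : C⦄ (k k' : K ⟶ B), (∀ M, ι M ≫ k = ι M ≫ k') → k = k') := by
    let d : Cocone F := ⟨A, { app := fun M => M.1.arrow, naturality := fun M M' f =>
      (Subobject.underlying_arrow (homOfLE (leOfHom f))).trans (Category.comp_id _).symm }⟩
    refine ⟨colimit F, fun M => colimit.ι F M, colimit.desc F d,
      mono_desc_of_isFiltered (colimit.isColimit F) d fun M => inferInstanceAs (Mono M.1.arrow),
      fun M => colimit.ι_desc d M, fun X g hX => ?_, fun B h hh => ?_, fun B k k' h => ?_⟩
    · obtain ⟨M, f, hf⟩ := IsCardinalPresentable.exists_hom_of_isColimit Cardinal.aleph0.{w}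
        (colimit.isColimit F) g
      exact ⟨M, f, hf⟩
    · let t : Cocone F := ⟨B, { app := h, naturality := fun M M' f =>
        (hh M M' (leOfHom f)).trans (Category.comp_id _).symm }⟩
      exact ⟨colimit.desc F t, fun M => colimit.ι_desc t M⟩
    · exact colimit.hom_ext h
  let e : (Subobject.mk m : C) ≅ K := Subobject.underlyingIso _
  have hle : ∀ M ∈ c, M ≤ Subobject.mk m := fun M hM =>
    Subobject.le_mk_of_comm (ι ⟨M, hM⟩) (hιm _)
  have hι (M : c) (h : M.1 ≤ Subobject.mk m) : M.1.ofLE _ h = ι M ≫ e.inv := by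
    rw [← cancel_mono (Subobject.mk m).arrow]
    simp [e, hιm]
  refine ⟨Subobject.mk m, hle, fun X g hX hg => ?_, fun B h hh => ?_, fun B k k' h => ?_⟩
  · rw [thru_mk_arrow_iff] at hg
    obtain ⟨k, rfl⟩ := hg
    obtain ⟨M, f, rfl⟩ := hfp X k hX
    exact ⟨M.1, M.2, f, by simp [hιm]⟩
  · obtain ⟨k, hk⟩ := hdesc h hh
    exact ⟨e.hom ≫ k, fun M hM => by rw [hι]; simp [hk]⟩
  · rw [← cancel_epi e.inv]
    refine hext _ _ fun M => ?_
    simpa [hι] using h M (hle _ M.2)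

end LocallyPresentable

/-! ### Colimits of coalgebras -/

section Colimits

variable {C : Type u} [Category.{w} C] {H : C ⥤ C} {J : Type u₁} [Category.{v₁} J]

/-- A leg of a colimit cocone on the underlying objects of coalgebras. -/
def coalgebraLeg {F : J ⥤ Endofunctor.Coalgebra H}
    (c : Cocone (F ⋙ Endofunctor.Coalgebra.forget H)) (j : J) : (F.obj j).V ⟶ c.pt := c.ι.app j

theorem map_coalgebraLeg {F : J ⥤ Endofunctor.Coalgebra H}
    (c : Cocone (F ⋙ Endofunctor.Coalgebra.forget H)) {i j : J} (f : i ⟶ j) :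
    (F.map f).f ≫ coalgebraLeg c j = coalgebraLeg c i := c.w f

/-- The coalgebra structure on a colimit of the underlying objects of coalgebras. -/
def colimitStr {F : J ⥤ Endofunctor.Coalgebra H}
    {c : Cocone (F ⋙ Endofunctor.Coalgebra.forget H)} (hc : IsColimit c) : c.pt ⟶ H.obj c.pt :=
  hc.desc ⟨H.obj c.pt,
    { app := fun j => (F.obj j).str ≫ H.map (coalgebraLeg c j)
      naturality := fun i j f => by
        change (F.map f).f ≫ (F.obj j).str ≫ H.map (coalgebraLeg c j) =
          ((F.obj i).str ≫ H.map (coalgebraLeg c i)) ≫ 𝟙 _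
        rw [← map_coalgebraLeg c f, H.map_comp, (F.map f).h_assoc, Category.comp_id] }⟩

theorem coalgebraLeg_colimitStr {F : J ⥤ Endofunctor.Coalgebra H}
    {c : Cocone (F ⋙ Endofunctor.Coalgebra.forget H)} (hc : IsColimit c) (j : J) :
    coalgebraLeg c j ≫ colimitStr hc = (F.obj j).str ≫ H.map (coalgebraLeg c j) :=
  hc.fac _ j

/-- The cocone of coalgebras on a colimit of the underlying objects. -/
def colimitCoalgebraCocone (F : J ⥤ Endofunctor.Coalgebra H)
    {c : Cocone (F ⋙ Endofunctor.Coalgebra.forget H)} (hc : IsColimit c) : Cocone F where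
  pt := ⟨c.pt, colimitStr hc⟩
  ι := { app := fun j => ⟨coalgebraLeg c j, (coalgebraLeg_colimitStr hc j).symm⟩
         naturality := fun i j f => by
          apply Endofunctor.Coalgebra.ext
          exact (map_coalgebraLeg c f).trans (Category.comp_id _).symm }

/-- The colimit of coalgebras is formed on the underlying objects. -/
def isColimitColimitCoalgebraCocone (F : J ⥤ Endofunctor.Coalgebra H)
    {c : Cocone (F ⋙ Endofunctor.Coalgebra.forget H)} (hc : IsColimit c) :
    IsColimit (colimitCoalgebraCocone F hc) where
  desc s := ⟨hc.desc ((Endofunctor.Coalgebra.forget H).mapCocone s), hc.hom_ext fun j => by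
    let d : c.pt ⟶ s.pt.V := hc.desc ((Endofunctor.Coalgebra.forget H).mapCocone s)
    have h : coalgebraLeg c j ≫ d = (s.ι.app j).f := hc.fac _ j
    change coalgebraLeg c j ≫ colimitStr hc ≫ H.map d = coalgebraLeg c j ≫ d ≫ s.pt.str
    rw [reassoc_of% coalgebraLeg_colimitStr hc j, reassoc_of% h, ← H.map_comp, h, (s.ι.app j).h]
    rfl⟩
  fac s j := by
    apply Endofunctor.Coalgebra.ext
    exact hc.fac ((Endofunctor.Coalgebra.forget H).mapCocone s) j
  uniq s m hm := by
    apply Endofunctor.Coalgebra.ext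
    exact hc.uniq ((Endofunctor.Coalgebra.forget H).mapCocone s) m.f fun j =>
      congrArg Endofunctor.Coalgebra.Hom.f (hm j)

theorem hasColimit_coalgebra (F : J ⥤ Endofunctor.Coalgebra H)
    [HasColimit (F ⋙ Endofunctor.Coalgebra.forget H)] : HasColimit F :=
  ⟨⟨_, isColimitColimitCoalgebraCocone F (colimit.isColimit _)⟩⟩

theorem preservesColimit_forget_coalgebra (F : J ⥤ Endofunctor.Coalgebra H)
    [HasColimit (F ⋙ Endofunctor.Coalgebra.forget H)] :
    PreservesColimit F (Endofunctor.Coalgebra.forget H) :=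
  preservesColimit_of_preserves_colimit_cocone
    (isColimitColimitCoalgebraCocone F (colimit.isColimit _)) (colimit.isColimit _)

/-- The legs of a colimit cocone of coalgebras do not all factor through a proper subobject. -/
theorem isIso_of_isColimit_coalgebra {F : J ⥤ Endofunctor.Coalgebra H}
    [HasColimit (F ⋙ Endofunctor.Coalgebra.forget H)] {c : Cocone F} (hc : IsColimit c) {M : C}
    (m : M ⟶ c.pt.V) [Mono m] (h : ∀ j, Thru (c.ι.app j).f m) : IsIso m := by
  have := preservesColimit_forget_coalgebra F
  have h₁ : Thru (𝟙 c.pt.V) m := thru_of_isColimit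
    (isColimitOfPreserves (Endofunctor.Coalgebra.forget H) hc) m (𝟙 c.pt.V) (fun j => by
      obtain ⟨k, hk⟩ := h j
      exact ⟨k, hk.trans (Category.comp_id _).symm⟩)
  exact isIso_of_thru h₁

end Colimits

/-! ### Simple quotients of coalgebras -/

section SimpleQuotient

theorem hasColimitsOfShape_coalgebra {C : Type u} [Category.{w} C] {H : C ⥤ C}
    (J : Type u₁) [Category.{v₁} J] [HasColimitsOfShape J C] :
    HasColimitsOfShape J (Endofunctor.Coalgebra H) where
  has_colimit F := hasColimit_coalgebra F

variable {C : Type u} [Category.{w} C] [IsLocallyFinitelyPresentable.{w} C] {H : C ⥤ C}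

/-- A coalgebra homomorphism factors as one carried by a strong epimorphism followed by one carried
by a monomorphism. -/
theorem exists_coalgebra_factorization (hH : PreservesIntersections.{w} H)
    {A B : Endofunctor.Coalgebra H} (f : A ⟶ B) :
    ∃ (M : Endofunctor.Coalgebra H) (e : A ⟶ M) (m : M ⟶ B), StrongEpi e.f ∧ Mono m.f ∧
      e ≫ m = f := by
  obtain ⟨M, e, m, he, hm, hem⟩ := exists_strongEpi_mono_factorization f.f
  have := hH.map_mono m
  -- The structure on the image is the diagonal between the strong epimorphism `e` and the
  -- monomorphism `H m`.
  have sq : CommSq (A.str ≫ H.map e) e (H.map m) (m ≫ B.str) := ⟨by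
    rw [Category.assoc, ← H.map_comp, hem, f.h, ← hem, Category.assoc]⟩
  exact ⟨⟨M, sq.lift⟩, ⟨e, sq.fac_left.symm⟩, ⟨m, sq.fac_right⟩, he, hm,
    Endofunctor.Coalgebra.ext hem⟩

/-- The strong epimorphism in the image factorization is a quotient of `A`, hence invertible. -/
theorem mono_of_isSimpleCoalgebra (hH : PreservesIntersections.{w} H)
    {A B : Endofunctor.Coalgebra H} (hA : IsSimpleCoalgebra A) (f : A ⟶ B) : Mono f.f := by
  obtain ⟨M, e, m, he, hm, rfl⟩ := exists_coalgebra_factorization hH f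
  have := hA e he
  exact mono_comp e.f m.f

/-- Parallel homomorphisms into a simple coalgebra are equal. -/
theorem hom_ext_of_isSimpleCoalgebra {A S : Endofunctor.Coalgebra H} (hS : IsSimpleCoalgebra S)
    (f g : A ⟶ S) : f = g := by
  have : HasCoequalizers C := hasColimitsOfShape_of_essentiallySmall.{w} WalkingParallelPair C
  -- The coequalizer of the carriers is a quotient coalgebra of `S`, so `q` is invertible.
  let q := coequalizer.π f.f g.f
  have hq : f.f ≫ q = g.f ≫ q := coequalizer.condition f.f g.f
  have hs : f.f ≫ S.str ≫ H.map q = g.f ≫ S.str ≫ H.map q := by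
    rw [← f.h_assoc, ← g.h_assoc, ← H.map_comp, ← H.map_comp, hq]
  have : IsIso q := hS (B := ⟨coequalizer f.f g.f, coequalizer.desc _ hs⟩)
    ⟨q, (coequalizer.π_desc _ hs).symm⟩ (inferInstanceAs (StrongEpi (coequalizer.π f.f g.f)))
  exact Endofunctor.Coalgebra.ext ((cancel_mono q).1 hq)

/-- Subcoalgebras of simple coalgebras are simple. -/
theorem IsSimpleCoalgebra.of_mono {A S : Endofunctor.Coalgebra H} (hS : IsSimpleCoalgebra S)
    (m : A ⟶ S) [Mono m.f] : IsSimpleCoalgebra A := by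
  intro B e he
  have : HasPushouts C := hasColimitsOfShape_of_essentiallySmall.{w} WalkingSpan C
  have : HasPushouts (Endofunctor.Coalgebra H) := hasColimitsOfShape_coalgebra _
  -- The pushout of `e` along `m` is a quotient of `S`, hence invertible; this makes `e` a first
  -- factor of a monomorphism.
  have h₁ : StrongEpi (pushout.inl m e).f := by
    refine strongEpi_of_forall_thru _ fun M n hn hM => ?_
    have hw : m.f ≫ (pushout.inl m e).f = e.f ≫ (pushout.inr m e).f :=
      congrArg Endofunctor.Coalgebra.Hom.f (pushout.condition (f := m) (g := e))
    refine isIso_of_isColimit_coalgebra (colimit.isColimit (span m e)) n ?_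
    rintro (_ | _ | _)
    · have h : (colimit.ι (span m e) WalkingSpan.zero).f = m.f ≫ (pushout.inl m e).f :=
        congrArg Endofunctor.Coalgebra.Hom.f (colimit.w (span m e) WalkingSpan.Hom.fst).symm
      obtain ⟨k, hk⟩ := hM.precomp m.f
      exact ⟨k, hk.trans h.symm⟩
    · exact hM
    · exact thru_of_strongEpi (e := e.f) (hw ▸ hM.precomp m.f)
  have h₂ := hS _ h₁
  have h₃ : m.f ≫ (pushout.inl m e).f = e.f ≫ (pushout.inr m e).f :=
    congrArg Endofunctor.Coalgebra.Hom.f (pushout.condition (f := m) (g := e))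
  have h₄ : Mono (e.f ≫ (pushout.inr m e).f) := h₃ ▸ mono_comp _ _
  have : Mono e.f := mono_of_mono _ (pushout.inr m e).f
  exact isIso_of_mono_of_strongEpi e.f

/-- Every coalgebra has a quotient identifying all pairs of maps from the objects of a small class
that are identified by some quotient. -/
theorem exists_quotient_identifying {P : ObjectProperty C} [ObjectProperty.Small.{w} P]
    (A : Endofunctor.Coalgebra H) :
    ∃ (N : Endofunctor.Coalgebra H) (η : A ⟶ N), StrongEpi η.f ∧
      ∀ (G : C), P G → ∀ (f g : G ⟶ A.V) (B : Endofunctor.Coalgebra H) (e : A ⟶ B),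
        StrongEpi e.f → f ≫ e.f = g ≫ e.f → f ≫ η.f = g ≫ η.f := by
  let G : Shrink.{w} (Subtype P) → C := fun i => ((equivShrink (Subtype P)).symm i).1
  -- The quotients of `A` need not form a set, so one is chosen for each pair of maps that some
  -- quotient identifies.
  let J := {t : Σ i, (G i ⟶ A.V) × (G i ⟶ A.V) // ∃ (B : Endofunctor.Coalgebra H) (e : A ⟶ B),
    StrongEpi e.f ∧ t.2.1 ≫ e.f = t.2.2 ≫ e.f}
  choose B e he heq using fun j : J => j.2
  have : HasColimitsOfShape (WidePushoutShape J) (Endofunctor.Coalgebra H) :=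
    hasColimitsOfShape_coalgebra _
  have hw (j : J) : (e j).f ≫ (WidePushout.ι e j).f = (WidePushout.head e).f :=
    congrArg Endofunctor.Coalgebra.Hom.f (WidePushout.arrow_ι e j)
  refine ⟨_, WidePushout.head e, strongEpi_of_forall_thru _ fun M m hm hM => ?_, ?_⟩
  · refine isIso_of_isColimit_coalgebra (colimit.isColimit (WidePushoutShape.wideSpan A B e)) m ?_
    rintro (_ | j)
    · exact hM
    · have := he j
      exact thru_of_strongEpi (e := (e j).f) ((hw j).symm ▸ hM)
  · intro G' hG f g B' e' he' h
    obtain ⟨i, rfl⟩ : ∃ i, G i = G' := ⟨equivShrink _ ⟨G', hG⟩, by simp [G]⟩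
    let j : J := ⟨⟨i, f, g⟩, B', e', he', h⟩
    rw [← hw j, ← Category.assoc, ← Category.assoc]
    exact congrArg (· ≫ (WidePushout.ι e j).f) (heq j)

/-- Every coalgebra has a simple quotient. -/
theorem exists_simple_quotient (A : Endofunctor.Coalgebra H) :
    ∃ (S : Endofunctor.Coalgebra H) (e : A ⟶ S), StrongEpi e.f ∧ IsSimpleCoalgebra S := by
  obtain ⟨P, hPs, hP, hfp⟩ := exists_finitelyPresentable_strongGenerator (C := C)
  choose N η hη hN using exists_quotient_identifying (H := H) (P := P)
  let X : ℕ → Endofunctor.Coalgebra H := fun n => n.rec A fun _ => N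
  -- Countably many iterations suffice: maps from finitely presentable generators into the colimit
  -- come from a finite stage, and what a quotient of the colimit identifies there is identified one
  -- stage later.
  let F : ℕ ⥤ Endofunctor.Coalgebra H := Functor.ofSequence (X := X) fun n => η (X n)
  have : HasColimitsOfShape ℕ C := hasColimitsOfShape_of_essentiallySmall.{w} ℕ C
  have : HasColimitsOfShape ℕ (Endofunctor.Coalgebra H) := hasColimitsOfShape_coalgebra _
  let ι (n : ℕ) : X n ⟶ colimit F := colimit.ι F n
  have hι (n : ℕ) : (η (X n)).f ≫ (ι (n + 1)).f = (ι n).f := by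
    have := colimit.w F (homOfLE n.le_succ)
    rw [Functor.ofSequence_map_homOfLE_succ] at this
    exact congrArg Endofunctor.Coalgebra.Hom.f this
  have hstrong (n : ℕ) : StrongEpi (ι n).f := by
    refine strongEpi_of_forall_thru _ fun M m hm hM => ?_
    refine isIso_of_isColimit_coalgebra (colimit.isColimit F) m fun k => ?_
    change Thru (ι k).f m
    have h₁ : Thru (ι 0).f m := by
      clear_value ι
      induction n with
      | zero => exact hM
      | succ n ih => exact ih (hι n ▸ hM.precomp _)
    induction k with
    | zero => exact h₁
    | succ k ih =>
      have := hη (X k)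
      exact thru_of_strongEpi (e := (η (X k)).f) ((hι k).symm ▸ ih)
  refine ⟨colimit F, ι 0, hstrong 0, fun B e he => ?_⟩
  have := preservesColimit_forget_coalgebra F
  let hc := isColimitOfPreserves (Endofunctor.Coalgebra.forget H) (colimit.isColimit F)
  have : IsCardinalFiltered ℕ Cardinal.aleph0.{w} := by
    rw [isCardinalFiltered_aleph0_iff]; infer_instance
  have hfac (G : C) (hG : P G) (f : G ⟶ (colimit F).V) : ∃ n, Thru f (ι n).f := by
    have := hfp G hG
    exact IsCardinalPresentable.exists_hom_of_isColimit Cardinal.aleph0.{w} hc f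
  have hthru (n k : ℕ) : Thru (ι n).f (ι (n + k)).f := by
    induction k with
    | zero => exact .refl _
    | succ k ih => exact ih.trans ⟨_, hι (n + k)⟩
  have : Mono e.f := ⟨fun {Z} u v huv => hP.isSeparating _ _ fun G hG g => by
    obtain ⟨n, hn⟩ := hfac G hG (g ≫ u)
    obtain ⟨k, hk⟩ := hfac G hG (g ≫ v)
    obtain ⟨a, ha⟩ := hn.trans (hthru n k)
    obtain ⟨b, hb⟩ := hk.trans (add_comm n k ▸ hthru k n)
    have := hstrong (n + k)
    have h := hN (X (n + k)) G hG a b B (ι (n + k) ≫ e) (strongEpi_comp _ _) (by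
      rw [Endofunctor.Coalgebra.comp_f, reassoc_of% ha, reassoc_of% hb, huv])
    rw [← ha, ← hb, ← hι, reassoc_of% h]⟩
  exact isIso_of_mono_of_strongEpi e.f

end SimpleQuotient

/-! ### Solutions of coalgebras in algebras -/

section Solutions

variable {C : Type u} [Category.{w} C] {H : C ⥤ C}

/-- The coalgebra-to-algebra homomorphisms. -/
def IsSolution (A : Endofunctor.Coalgebra H) (B : Endofunctor.Algebra H) (h : A.V ⟶ B.a) : Prop :=
  A.str ≫ H.map h ≫ B.str = h

theorem IsSolution.precomp {A A' : Endofunctor.Coalgebra H} {B : Endofunctor.Algebra H}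
    {h : A.V ⟶ B.a} (hh : IsSolution A B h) (f : A' ⟶ A) : IsSolution A' B (f.f ≫ h) := by
  rw [IsSolution, H.map_comp, Category.assoc, f.h_assoc, hh]

/-- A solution `l'` on `A'` is recovered from its restriction `i ≫ l'` to `A` as `q ≫ H (i ≫ l') ≫
B.str`. This handles the next-time step of the recursion. -/
theorem existsUnique_isSolution_of_factor {A A' : Endofunctor.Coalgebra H}
    {B : Endofunctor.Algebra H} (i : A ⟶ A') (q : A'.V ⟶ H.obj A.V) (hq : q ≫ H.map i.f = A'.str)
    (hi : i.f ≫ q = A.str) (h : ∃! h, IsSolution A B h) : ∃! h, IsSolution A' B h := by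
  obtain ⟨l, hl, hu⟩ := h
  have h₁ : i.f ≫ q ≫ H.map l ≫ B.str = l := by rw [reassoc_of% hi]; exact hl
  refine ⟨q ≫ H.map l ≫ B.str, ?_, fun l' hl' => ?_⟩
  · change A'.str ≫ H.map (q ≫ H.map l ≫ B.str) ≫ B.str = _
    rw [← hq, Category.assoc, ← H.map_comp_assoc, h₁]
  · rw [← hu _ (hl'.precomp i), H.map_comp, Category.assoc, reassoc_of% hq]
    exact hl'.symm

theorem existsUnique_isSolution_of_isIso {A A' : Endofunctor.Coalgebra H}
    {B : Endofunctor.Algebra H} (i : A ⟶ A') [IsIso i.f] (h : ∃! h, IsSolution A B h) :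
    ∃! h, IsSolution A' B h :=
  existsUnique_isSolution_of_factor i (inv i.f ≫ A.str) (by simp) (by simp) h

end Solutions

/-! ### Well-founded coalgebras -/

section WellFounded

variable {C : Type u} [Category.{w} C] [IsLocallyFinitelyPresentable.{w} C] {H : C ⥤ C}

theorem thru_pullback_fst_iff {A B M X : C} (f : A ⟶ B) (m : M ⟶ B) (g : X ⟶ A) :
    Thru g (pullback.fst f m) ↔ Thru (g ≫ f) m := by
  refine ⟨?_, ?_⟩
  · rintro ⟨k, rfl⟩
    exact ⟨k ≫ pullback.snd f m, by
      rw [Category.assoc, Category.assoc, pullback.condition]⟩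
  · rintro ⟨k, hk⟩
    exact ⟨pullback.lift g k hk.symm, pullback.lift_fst _ _ _⟩

/-- The next-time operator: the inverse image of `H m` under the structure of the coalgebra. -/
noncomputable def nextTime (A : Endofunctor.Coalgebra H) {M : C} (m : M ⟶ A.V) :
    pullback A.str (H.map m) ⟶ A.V := pullback.fst _ _

theorem thru_nextTime_iff (A : Endofunctor.Coalgebra H) {M X : C} (m : M ⟶ A.V) (g : X ⟶ A.V) :
    Thru g (nextTime A m) ↔ Thru (g ≫ A.str) (H.map m) :=
  thru_pullback_fst_iff _ _ _

theorem mono_nextTime (hH : PreservesIntersections.{w} H) (A : Endofunctor.Coalgebra H) {M : C}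
    (m : M ⟶ A.V) [Mono m] : Mono (nextTime A m) :=
  have := hH.map_mono m
  inferInstanceAs (Mono (pullback.fst _ _))

theorem nextTime_thru_nextTime (A : Endofunctor.Coalgebra H) {M N : C} {m : M ⟶ A.V}
    {n : N ⟶ A.V} (h : Thru m n) : Thru (nextTime A m) (nextTime A n) :=
  (thru_nextTime_iff A n _).2 (((thru_nextTime_iff A m _).1 (.refl _)).trans (h.map H))

theorem isWellFoundedCoalgebra_of_forall (A : Endofunctor.Coalgebra H)
    (h : ∀ ⦃M : C⦄ (m : M ⟶ A.V), Mono m → Thru (nextTime A m) m → IsIso m) :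
    IsWellFoundedCoalgebra A := by
  intro B m hm hp
  refine h m.f hm ?_
  obtain ⟨k, hk⟩ := (thru_nextTime_iff A m.f _).1 (.refl _)
  exact ⟨hp.lift k (nextTime A m.f) hk, hp.lift_snd _ _ _⟩

/-- Knaster–Tarski: the intersection `n` of all subobjects closed under `nextTime` is its least
fixed point, that is, a cartesian subcoalgebra. Hence `n` is invertible, and so is everything above
it. -/
theorem IsWellFoundedCoalgebra.isIso (hH : PreservesIntersections.{w} H)
    {A : Endofunctor.Coalgebra H} (hA : IsWellFoundedCoalgebra A) {M : C} (m : M ⟶ A.V) [Mono m]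
    (h : Thru (nextTime A m) m) : IsIso m := by
  obtain ⟨W, n, hn, hW, -⟩ :=
    exists_intersection_of_subobjects (fun N : Subobject A.V => Thru (nextTime A N.arrow) N.arrow)
  have h₁ : Thru (nextTime A n) n := (hW _).2 fun N hN =>
    (nextTime_thru_nextTime A ((hW n).1 (.refl n) N hN)).trans hN
  have hle {K : C} (k : K ⟶ A.V) [Mono k] (hk : Thru (nextTime A k) k) : Thru n k := by
    rw [← thru_mk_arrow_iff]
    refine (hW n).1 (.refl n) _ ?_
    rw [thru_mk_arrow_iff]
    exact (nextTime_thru_nextTime A ((thru_mk_arrow_iff _ k).1 (.refl _))).trans hk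
  have := mono_nextTime hH A n
  have := hH.map_mono n
  -- The next-time of `n` is itself closed, so it contains `n`; this provides the coalgebra
  -- structure `s`.
  obtain ⟨s, hs⟩ := (thru_nextTime_iff A n n).1 (hle _ (nextTime_thru_nextTime A h₁))
  have hp : IsPullback s n (H.map n) A.str := by
    refine ⟨⟨hs⟩, ⟨PullbackCone.IsLimit.mk _ (fun t => ?_) (fun t => ?_) (fun t => ?_) ?_⟩⟩
    · exact (((thru_nextTime_iff A n t.snd).2 ⟨t.fst, t.condition⟩).trans h₁).choose
    · have := (((thru_nextTime_iff A n t.snd).2 ⟨t.fst, t.condition⟩).trans h₁).choose_spec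
      rw [← cancel_mono (H.map n), Category.assoc, hs, reassoc_of% this, t.condition]
    · exact (((thru_nextTime_iff A n t.snd).2 ⟨t.fst, t.condition⟩).trans h₁).choose_spec
    · intro t l _ hl
      rw [← cancel_mono n, hl]
      exact (((thru_nextTime_iff A n t.snd).2 ⟨t.fst, t.condition⟩).trans h₁).choose_spec.symm
  have : IsIso n := hA (B := ⟨W, s⟩) ⟨n, hs⟩ hn hp
  exact isIso_of_thru (hle m h)

/-- A coalgebra covered by a family of well-founded ones is well-founded. -/
theorem isWellFoundedCoalgebra_of_cover (hH : PreservesIntersections.{w} H) {ι : Type u₁}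
    {A : ι → Endofunctor.Coalgebra H} {B : Endofunctor.Coalgebra H} (f : ∀ i, A i ⟶ B)
    (hA : ∀ i, IsWellFoundedCoalgebra (A i))
    (hf : ∀ ⦃M : C⦄ (m : M ⟶ B.V), Mono m → (∀ i, Thru (f i).f m) → IsIso m) :
    IsWellFoundedCoalgebra B := by
  refine isWellFoundedCoalgebra_of_forall B fun M m hm h => hf m hm fun i => ?_
  -- The inverse image of a closed subobject along a homomorphism is closed.
  have : IsIso (pullback.fst (f i).f m) := by
    refine (hA i).isIso hH _ ?_
    rw [thru_pullback_fst_iff]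
    refine Thru.trans ?_ h
    rw [thru_nextTime_iff, Category.assoc, ← (f i).h, ← Category.assoc]
    refine (((thru_nextTime_iff (A i) (pullback.fst (f i).f m) _).1 (.refl _)).postcomp
      (H.map (f i).f)).trans ?_
    rw [← H.map_comp, pullback.condition]
    exact Thru.map H ⟨_, rfl⟩
  simpa [thru_pullback_fst_iff] using thru_of_isIso (𝟙 _) (pullback.fst (f i).f m)

theorem IsWellFoundedCoalgebra.of_strongEpi (hH : PreservesIntersections.{w} H)
    {A B : Endofunctor.Coalgebra H} (hA : IsWellFoundedCoalgebra A) (e : A ⟶ B) [StrongEpi e.f] :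
    IsWellFoundedCoalgebra B :=
  isWellFoundedCoalgebra_of_cover hH (fun _ : Unit => e) (fun _ => hA)
    fun _ _ _ h => isIso_of_strongEpi_of_thru (h ())

/-- If `m` is closed in `H A`, its inverse image along the structure of `A` is closed, hence all of
`A`; `H` of that inverse image factors through `m`. -/
theorem IsWellFoundedCoalgebra.map (hH : PreservesIntersections.{w} H)
    {A : Endofunctor.Coalgebra H} (hA : IsWellFoundedCoalgebra A) :
    IsWellFoundedCoalgebra (⟨H.obj A.V, H.map A.str⟩ : Endofunctor.Coalgebra H) := by
  refine isWellFoundedCoalgebra_of_forall _ fun M m hm h => ?_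
  have h₁ : Thru (H.map (pullback.fst A.str m)) m := by
    refine Thru.trans ?_ h
    refine (thru_nextTime_iff (⟨H.obj A.V, H.map A.str⟩ : Endofunctor.Coalgebra H) m _).2 ?_
    change Thru (H.map _ ≫ H.map A.str) _
    rw [← H.map_comp, pullback.condition]
    exact Thru.map H ⟨_, rfl⟩
  have : IsIso (pullback.fst A.str m) := by
    refine hA.isIso hH _ ?_
    rw [thru_pullback_fst_iff]
    exact ((thru_nextTime_iff A _ _).1 (.refl _)).trans h₁
  exact isIso_of_thru h₁

/-! ### Induction over the subobjects of a well-founded coalgebra -/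

/-- The image of the map from the initial object is a strong quotient of it. Simplicity of the
initial object enters only here, to start the induction below. -/
theorem mono_of_isInitial_of_isSimpleObject {Z : C} (hZ : IsInitial Z) (hZs : IsSimpleObject Z)
    (A : C) : Mono (hZ.to A) := by
  obtain ⟨M, e, m, he, hm, hem⟩ := exists_strongEpi_mono_factorization (hZ.to A)
  have := hZs e he
  rw [← hem]
  exact mono_comp e m

theorem IsUnion.thru {C : Type u} [Category.{w} C] {A B M : C} {c : Set (Subobject A)}
    {N : Subobject A} (hN : IsUnion c N)
    {m : M ⟶ B} [Mono m] {g : A ⟶ B} (h : ∀ K ∈ c, Thru (K.arrow ≫ g) m) :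
    Thru (N.arrow ≫ g) m := by
  choose l hl using h
  obtain ⟨k, hk⟩ := hN.exists_desc (fun K => l K.1 K.2) fun K K' hle => by
    simp [← cancel_mono m, hl]
  refine ⟨k, hN.hom_ext _ _ fun K hle => ?_⟩
  rw [reassoc_of% hk K hle]
  simp [hl]

/-- Induction over the subobjects of a well-founded coalgebra. -/
theorem IsWellFoundedCoalgebra.induction (hH : PreservesIntersections.{w} H) {Z : C}
    (hZ : IsInitial Z) (hZs : IsSimpleObject Z) {A : Endofunctor.Coalgebra H}
    (hA : IsWellFoundedCoalgebra A) {P : Subobject A.V → Prop}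
    (hbot : ∀ _ : Mono (hZ.to A.V), P (Subobject.mk (hZ.to A.V)))
    (hnext : ∀ (N : Subobject A.V) (_ : Mono (nextTime A N.arrow)),
      Thru N.arrow (nextTime A N.arrow) → P N → P (Subobject.mk (nextTime A N.arrow)))
    (hunion : ∀ (c : Set (Subobject A.V)) (N : Subobject A.V), IsUnion c N → (∀ M ∈ c, P M) →
      Thru N.arrow (nextTime A N.arrow) → P N) : P ⊤ := by
  obtain ⟨N, ⟨hN, hN'⟩, hmax⟩ :=
    -- Zorn's lemma replaces transfinite iteration of `nextTime`. A maximal `N` equals its own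
    -- next-time, and well-foundedness makes it everything.
    zorn_le₀ {N : Subobject A.V | P N ∧ Thru N.arrow (nextTime A N.arrow)} fun c hc hch => by
      rcases c.eq_empty_or_nonempty with rfl | hne
      · have := mono_of_isInitial_of_isSimpleObject hZ hZs A.V
        refine ⟨_, ⟨hbot this, ?_⟩, by simp⟩
        exact ((thru_mk_arrow_iff _ _).1 (.refl _)).trans ⟨hZ.to _, hZ.hom_ext _ _⟩
      · obtain ⟨N, hN⟩ := exists_isUnion_of_isChain c hch hne
        have := hH.map_mono N.arrow
        have h : Thru N.arrow (nextTime A N.arrow) := by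
          rw [thru_nextTime_iff]
          refine hN.thru fun K hK => ?_
          exact ((thru_nextTime_iff _ _ _).1 (hc hK).2).trans
            (Thru.map H ⟨K.ofLE N (hN.le K hK), by simp⟩)
        exact ⟨N, ⟨hunion c N hN (fun M hM => (hc hM).1) h, h⟩, hN.le⟩
  have hm := mono_nextTime hH A N.arrow
  have hle : N ≤ Subobject.mk (nextTime A N.arrow) := by
    obtain ⟨k, hk⟩ := hN'
    exact Subobject.le_mk_of_comm k hk
  have h₁ : Thru (Subobject.mk (nextTime A N.arrow)).arrow N.arrow := by
    have := hmax ⟨hnext N hm hN' hN, ?_⟩ hle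
    · exact ⟨Subobject.ofLE _ _ this, by simp⟩
    · exact ((thru_mk_arrow_iff _ _).1 (.refl _)).trans
        (nextTime_thru_nextTime A ((thru_mk_arrow_iff _ _).2 hN'))
  have := hA.isIso hH N.arrow (((thru_mk_arrow_iff _ _).2 (.refl _)).trans h₁)
  rwa [(Subobject.isIso_arrow_iff_eq_top N).1 this] at hN

/-- The inverse image of `m` along `g` is a subobject of `X` through which all maps from generators
factor, hence is invertible. -/
theorem thru_of_isStrongGenerator {P : ObjectProperty C} (hP : P.IsStrongGenerator) {X M A : C}
    {g : X ⟶ A} {m : M ⟶ A} [Mono m]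
    (h : ∀ G, P G → ∀ x : G ⟶ X, Thru (x ≫ g) m) : Thru g m := by
  have : IsIso (pullback.fst g m) := hP.isIso_of_mono _ fun G hG x =>
    (thru_pullback_fst_iff g m x).2 (h G hG x)
  simpa [thru_pullback_fst_iff] using thru_of_isIso (𝟙 _) (pullback.fst g m)

/-- Binary intersections of subobjects. -/
theorem exists_isIntersection_pair {B M N : C} (m : M ⟶ B) (n : N ⟶ B) [Mono m] [Mono n] :
    ∃ (W : C) (r : W ⟶ B) (J : Type w) (K : J → Subobject B),
      IsIntersection (fun j => (K j).arrow) r ∧ Thru r m ∧ Thru r n ∧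
      ∀ {D : Type u₂} [Category.{v₂} D] (F : C ⥤ D) ⦃Y : D⦄ (g : Y ⟶ F.obj B),
        Thru g (F.map m) → Thru g (F.map n) → ∀ j, Thru g (F.map (K j).arrow) := by
  obtain ⟨W, r, hr⟩ := exists_isIntersection
    (fun j : ULift.{w} Bool => (if j.down then Subobject.mk m else Subobject.mk n).arrow)
    (fun _ => inferInstance)
  refine ⟨W, r, _, _, hr, ?_, ?_, ?_⟩
  · simpa [thru_mk_arrow_iff] using (hr.thru_iff r).1 (.refl r) ⟨true⟩
  · simpa [thru_mk_arrow_iff] using (hr.thru_iff r).1 (.refl r) ⟨false⟩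
  · rintro D _ F Y g hm hn ⟨_ | _⟩
    · exact hn.trans (((thru_mk_arrow_iff _ _).2 (.refl n)).map F)
    · exact hm.trans (((thru_mk_arrow_iff _ _).2 (.refl m)).map F)

/-- Subcoalgebras of well-founded coalgebras are well-founded. -/
theorem IsWellFoundedCoalgebra.of_mono (hH : PreservesIntersections.{w} H) {Z : C}
    (hZ : IsInitial Z) (hZs : IsSimpleObject Z) {A S : Endofunctor.Coalgebra H}
    (hA : IsWellFoundedCoalgebra A) (s : S ⟶ A) [Mono s.f] : IsWellFoundedCoalgebra S := by
  refine isWellFoundedCoalgebra_of_forall S fun M m hm h => ?_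
  -- The property of `N` says that the inverse image of `N` in `S` lies in `m`.
  have key := hA.induction hH hZ hZs
    (P := fun N => ∀ ⦃X : C⦄ (g : X ⟶ S.V), Thru (g ≫ s.f) N.arrow → Thru g m) ?_ ?_ ?_
  · exact isIso_of_thru (key (𝟙 S.V) (thru_of_isIso _ _))
  · intro _ X g hg
    rw [thru_mk_arrow_iff] at hg
    obtain ⟨k, hk⟩ := hg
    refine ⟨k ≫ hZ.to M, ?_⟩
    rw [← cancel_mono s.f, ← hk, Category.assoc, Category.assoc]
    congr 1
    exact hZ.hom_ext _ _
  · intro N _ _ hN X g hg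
    rw [thru_mk_arrow_iff, thru_nextTime_iff, Category.assoc, ← s.h, ← Category.assoc] at hg
    -- The intersection `r` of `S` and `N` lies in `m` by induction. Since `H` preserves it, the
    -- structure sends `g` into `H m`, so `g` lies in the next-time of `m`.
    obtain ⟨W, r, J, K, hr, ⟨i, hi⟩, hrN, hF⟩ := exists_isIntersection_pair s.f N.arrow
    have h₁ := hH.map_thru (fun _ => inferInstance) hr _ (hF H _ ⟨_, rfl⟩ hg)
    have h₂ : Thru r (m ≫ s.f) := hi ▸ (hN i (hi ▸ hrN)).postcomp s.f
    have := hH.map_mono s.f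
    obtain ⟨k, hk⟩ := h₁.trans (h₂.map H)
    refine Thru.trans ((thru_nextTime_iff S m g).2 ⟨k, ?_⟩) h
    rw [← cancel_mono (H.map s.f), Category.assoc, ← H.map_comp, hk]
  · intro c N hN hc _ X g hg
    -- Intersecting with `S` is not assumed to commute with the union, so the claim is tested on
    -- finitely presentable generators, whose maps to `N` land in a member of the chain.
    obtain ⟨P, -, hP, hfp⟩ := exists_finitelyPresentable_strongGenerator (C := C)
    refine thru_of_isStrongGenerator hP fun G hG x => ?_
    obtain ⟨K, hK, hKx⟩ := hN.exists_thru (x ≫ g ≫ s.f) (hfp G hG) (hg.precomp x)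
    exact hc K hK (x ≫ g) (by rwa [Category.assoc])

/-! ### Recursion -/

/-- Well-founded coalgebras are recursive. -/
theorem IsWellFoundedCoalgebra.existsUnique_isSolution (hH : PreservesIntersections.{w} H) {Z : C}
    (hZ : IsInitial Z) (hZs : IsSimpleObject Z) {A : Endofunctor.Coalgebra H}
    (hA : IsWellFoundedCoalgebra A) (B : Endofunctor.Algebra H) : ∃! h, IsSolution A B h := by
  let P (N : Subobject A.V) : Prop := ∃ s : (N : C) ⟶ H.obj (N : C),
    s ≫ H.map N.arrow = N.arrow ≫ A.str ∧ ∃! h, IsSolution ⟨(N : C), s⟩ B h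
  have hmk {M : C} (m : M ⟶ A.V) [Mono m] (s : M ⟶ H.obj M) (hs : s ≫ H.map m = m ≫ A.str)
      (h : ∃! h, IsSolution ⟨M, s⟩ B h) : P (Subobject.mk m) := by
    let e : (Subobject.mk m : C) ≅ M := Subobject.underlyingIso m
    have he : e.hom ≫ m = (Subobject.mk m).arrow := Subobject.underlyingIso_hom_comp_eq_mk m
    refine ⟨e.hom ≫ s ≫ H.map e.inv, ?_,
      existsUnique_isSolution_of_isIso (A := ⟨M, s⟩) ⟨e.inv, by simp⟩ h⟩
    rw [← he, Category.assoc, Category.assoc, Category.assoc, ← H.map_comp, e.inv_hom_id_assoc, hs]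
  have key : P ⊤ := hA.induction hH hZ hZs ?_ ?_ ?_
  · obtain ⟨s, hs, h⟩ := key
    exact existsUnique_isSolution_of_isIso
      (A := ⟨((⊤ : Subobject A.V) : C), s⟩) ⟨(⊤ : Subobject A.V).arrow, hs⟩ h
  · intro _
    refine hmk _ (hZ.to _) (hZ.hom_ext _ _) ⟨hZ.to _, hZ.hom_ext _ _, fun _ _ => hZ.hom_ext _ _⟩
  · rintro N _ ⟨i, hi⟩ ⟨s, hs, h⟩
    -- With structure `q ≫ H i`, the next-time object is a coalgebra whose structure factors through
    -- `H N`.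
    let q : pullback A.str (H.map N.arrow) ⟶ H.obj (N : C) := pullback.snd _ _
    have hq : nextTime A N.arrow ≫ A.str = q ≫ H.map N.arrow := pullback.condition
    have := hH.map_mono N.arrow
    have hs' : i ≫ q = s := by
      rw [← cancel_mono (H.map N.arrow), Category.assoc, ← hq, reassoc_of% hi, hs]
    refine hmk _ (q ≫ H.map i) (by rw [Category.assoc, ← H.map_comp, hi, hq]) ?_
    exact existsUnique_isSolution_of_factor (A := ⟨(N : C), s⟩)
      ⟨i, by simp [reassoc_of% hs']⟩ q rfl hs' h
  · intro c N hN hc h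
    obtain ⟨s, hs⟩ := (thru_nextTime_iff A N.arrow N.arrow).1 h
    choose t ht l hl hu using hc
    have hom {K L : Subobject A.V} (hle : K ≤ L) {k : (K : C) ⟶ H.obj (K : C)}
        {l : (L : C) ⟶ H.obj (L : C)} (hk : k ≫ H.map K.arrow = K.arrow ≫ A.str)
        (hl : l ≫ H.map L.arrow = L.arrow ≫ A.str) :
        k ≫ H.map (K.ofLE L hle) = K.ofLE L hle ≫ l := by
      have := hH.map_mono L.arrow
      rw [← cancel_mono (H.map L.arrow), Category.assoc, ← H.map_comp, Subobject.ofLE_arrow, hk,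
        Category.assoc, hl, Subobject.ofLE_arrow_assoc]
    -- Uniqueness on the smaller member makes the solutions compatible, so they glue on the union.
    obtain ⟨k, hk⟩ := hN.exists_desc (fun K => l K.1 K.2) fun K L hle =>
      hu K.1 K.2 _ ((hl L.1 L.2).precomp (A' := ⟨(K.1 : C), t K.1 K.2⟩)
        ⟨K.1.ofLE L.1 hle, hom hle (ht _ _) (ht _ _)⟩)
    refine ⟨s, hs, k, hN.hom_ext _ _ fun K hle => ?_, fun k' hk' => hN.hom_ext _ _ fun K hle => ?_⟩
    · change K.1.ofLE N hle ≫ s ≫ H.map k ≫ B.str = _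
      rw [← reassoc_of% hom hle (ht K.1 K.2) hs, ← H.map_comp_assoc, hk]
      exact hl K.1 K.2
    · rw [hk]
      exact hu K.1 K.2 _ (hk'.precomp (A' := ⟨(K.1 : C), t K.1 K.2⟩)
        ⟨K.1.ofLE N hle, hom hle (ht _ _) hs⟩)

end WellFounded

/-! ### Pointed coalgebras -/

namespace PointedCoalgebra

section Basic

variable {C : Type u} [Category.{w} C] {H : C ⥤ C} {U : C ⥤ Type w}

theorem hom_ext {P Q : PointedCoalgebra H U} {f g : P ⟶ Q} (h : f.hom.f = g.hom.f) : f = g :=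
  Hom.ext (Endofunctor.Coalgebra.ext h)

theorem isIso_of_isIso_f {P Q : PointedCoalgebra H U} (f : P ⟶ Q) [IsIso f.hom.f] : IsIso f := by
  have : IsIso f.hom := Endofunctor.Coalgebra.iso_of_iso f.hom
  have h : U.map (inv f.hom).f Q.pt = P.pt := by
    have h₁ : f.hom.f ≫ (inv f.hom).f = 𝟙 _ :=
      congrArg Endofunctor.Coalgebra.Hom.f (IsIso.hom_inv_id f.hom)
    rw [← f.map_pt, ← Functor.map_comp_apply, h₁]
    simp
  exact ⟨⟨inv f.hom, h⟩, Hom.ext (IsIso.hom_inv_id f.hom), Hom.ext (IsIso.inv_hom_id f.hom)⟩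

theorem isIso_f {P Q : PointedCoalgebra H U} (f : P ⟶ Q) [IsIso f] : IsIso f.hom.f :=
  ⟨(inv f).hom.f,
    congrArg (fun k : P ⟶ P => k.hom.f) (IsIso.hom_inv_id f),
    congrArg (fun k : Q ⟶ Q => k.hom.f) (IsIso.inv_hom_id f)⟩

theorem IsWellPointed.isSimpleCoalgebra {P : PointedCoalgebra H U} (hP : P.IsWellPointed) :
    IsSimpleCoalgebra P.coalg := by
  intro B e he
  let f : P ⟶ ⟨B, U.map e.f P.pt⟩ := ⟨e, rfl⟩
  have : IsIso f := hP.1 f he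
  exact isIso_f f

end Basic

variable {C : Type u} [Category.{w} C] [IsLocallyFinitelyPresentable.{w} C] {H : C ⥤ C}
  {U : C ⥤ Type w}

/-- Since `H m` and `U m` are monic, any factorization in the base is automatically a homomorphism
and preserves the point. -/
theorem exists_comp_eq {C : Type u} [Category.{w} C] {H : C ⥤ C} {U : C ⥤ Type w}
    (hH : PreservesIntersections.{w} H) (hU : PreservesIntersections.{w} U)
    {R Q S : PointedCoalgebra H U} (r : R ⟶ S) (m : Q ⟶ S) [Mono m.hom.f]
    (h : Thru r.hom.f m.hom.f) : ∃ k : R ⟶ Q, k ≫ m = r := by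
  obtain ⟨k, hk⟩ := h
  have := hH.map_mono m.hom.f
  have := hU.map_mono m.hom.f
  refine ⟨⟨⟨k, ?_⟩, ?_⟩, hom_ext hk⟩
  · rw [← cancel_mono (H.map m.hom.f), Category.assoc, ← H.map_comp, hk, Category.assoc, m.hom.h,
      r.hom.h, ← hk, Category.assoc]
  · apply (mono_iff_injective (U.map m.hom.f)).1 this
    rw [← Functor.map_comp_apply, hk, m.map_pt, r.map_pt]

/-- Preservation by `H` gives the structure on the intersection, and preservation by `U` puts the
common point in it. -/
theorem exists_intersection (hH : PreservesIntersections.{w} H)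
    (hU : PreservesIntersections.{w} U) {J : Type w} {S : PointedCoalgebra H U}
    {Q : J → PointedCoalgebra H U} (m : ∀ j, Q j ⟶ S) (hm : ∀ j, Mono (m j).hom.f) :
    ∃ (R : PointedCoalgebra H U) (r : R ⟶ S), Mono r.hom.f ∧ ∀ j, ∃ k : R ⟶ Q j, k ≫ m j = r := by
  obtain ⟨W, n, hn⟩ := exists_isIntersection (fun j => (m j).hom.f) hm
  obtain ⟨s, hs⟩ : Thru (n ≫ S.coalg.str) (H.map n) := by
    refine hH.map_thru hm hn _ fun j => ?_
    obtain ⟨k, hk⟩ := (hn.thru_iff n).1 (.refl n) j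
    exact ⟨k ≫ (Q j).coalg.str, by rw [Category.assoc, (m j).hom.h, reassoc_of% hk]⟩
  obtain ⟨p, hp⟩ : Thru (↾fun _ : PUnit.{w + 1} => S.pt) (U.map n) := by
    refine hU.map_thru hm hn _ fun j => ⟨↾fun _ => (Q j).pt, ?_⟩
    ext
    exact (m j).map_pt
  let r : (⟨⟨W, s⟩, p PUnit.unit⟩ : PointedCoalgebra H U) ⟶ S :=
    ⟨⟨n, hs⟩, congrArg (fun k : PUnit.{w + 1} ⟶ U.obj S.coalg.V => k PUnit.unit) hp⟩
  refine ⟨_, r, hn.mono, fun j => ?_⟩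
  have := hm j
  exact exists_comp_eq hH hU r (m j) ((hn.thru_iff n).1 (.refl n) j)

theorem exists_intersection_pair (hH : PreservesIntersections.{w} H)
    (hU : PreservesIntersections.{w} U) {P Q S : PointedCoalgebra H U} (m : P ⟶ S) (n : Q ⟶ S)
    (hm : Mono m.hom.f) (hn : Mono n.hom.f) :
    ∃ (R : PointedCoalgebra H U) (k : R ⟶ P) (l : R ⟶ Q), Mono k.hom.f ∧ Mono l.hom.f ∧
      k ≫ m = l ≫ n := by
  let X : ULift.{w} Bool → PointedCoalgebra H U := fun b => b.down.rec Q P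
  let f : ∀ b, X b ⟶ S := fun ⟨b⟩ => match b with
    | true => m
    | false => n
  obtain ⟨R, r, hr, h⟩ := exists_intersection hH hU f (by rintro ⟨_ | _⟩; exacts [hn, hm])
  obtain ⟨k, hk⟩ : ∃ k : R ⟶ P, k ≫ m = r := h ⟨true⟩
  obtain ⟨l, hl⟩ : ∃ k : R ⟶ Q, k ≫ n = r := h ⟨false⟩
  refine ⟨R, k, l, ?_, ?_, hk.trans hl.symm⟩
  · have : Mono (k.hom.f ≫ m.hom.f) := by rwa [← hk] at hr
    exact mono_of_mono k.hom.f m.hom.f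
  · have : Mono (l.hom.f ≫ n.hom.f) := by rwa [← hl] at hr
    exact mono_of_mono l.hom.f n.hom.f

/-- There is a least subcoalgebra containing a given point. -/
theorem exists_least (hH : PreservesIntersections.{w} H) (hU : PreservesIntersections.{w} U)
    (S : PointedCoalgebra H U) :
    ∃ (Q : PointedCoalgebra H U) (m : Q ⟶ S), Mono m.hom.f ∧
      ∀ ⦃Q' : PointedCoalgebra H U⦄ (m' : Q' ⟶ S), Mono m'.hom.f → ∃ k : Q ⟶ Q', k ≫ m' = m := by
  let T := {N : Subobject S.coalg.V // ∃ (Q : PointedCoalgebra H U) (m : Q ⟶ S)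
    (_ : Mono m.hom.f), Subobject.mk m.hom.f = N}
  choose Q m hm hN using fun t : T => t.2
  obtain ⟨R, r, hr, h⟩ := exists_intersection hH hU
    (fun j => m ((equivShrink.{w} T).symm j)) (fun j => hm _)
  refine ⟨R, r, hr, fun Q' m' hm' => exists_comp_eq hH hU r m' ?_⟩
  let t : T := ⟨Subobject.mk m'.hom.f, Q', m', hm', rfl⟩
  have h₁ : ∀ t', (equivShrink T).symm (equivShrink T t) = t' → Thru r.hom.f (m t').hom.f := by
    rintro _ rfl
    obtain ⟨k, hk⟩ := h (equivShrink T t)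
    exact ⟨k.hom.f, congrArg (fun k : R ⟶ S => k.hom.f) hk⟩
  replace h₁ := h₁ t ((equivShrink T).symm_apply_apply t)
  have := hm t
  rw [← thru_mk_arrow_iff, hN t, thru_mk_arrow_iff] at h₁
  exact h₁

/-- Take the least subcoalgebra containing the point: minimality excludes proper subobjects, and
subcoalgebras of simple coalgebras are simple. -/
theorem exists_isWellPointed (hH : PreservesIntersections.{w} H)
    (hU : PreservesIntersections.{w} U) {S : PointedCoalgebra H U}
    (hS : IsSimpleCoalgebra S.coalg) :
    ∃ (Q : PointedCoalgebra H U) (m : Q ⟶ S), Mono m.hom.f ∧ Q.IsWellPointed := by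
  obtain ⟨Q, m, hm, h⟩ := exists_least hH hU S
  refine ⟨Q, m, hm, fun Q' e he => ?_, fun Q' m' hm' => ?_⟩
  · have : IsIso e.hom.f := hS.of_mono m.hom e.hom he
    exact isIso_of_isIso_f e
  · obtain ⟨k, hk⟩ := h (m' ≫ m) (mono_comp m'.hom.f m.hom.f)
    have h₁ : k.hom.f ≫ m'.hom.f = 𝟙 _ := by
      rw [← cancel_mono m.hom.f, Category.assoc, Category.id_comp]
      exact congrArg (fun k : Q ⟶ S => k.hom.f) hk
    have : IsIso m'.hom.f := isIso_of_thru ⟨_, h₁⟩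
    exact isIso_of_isIso_f m'

/-- Both morphisms are monic by simplicity. Their intersection is a subobject of `P` and of `Q`,
hence isomorphic to each. -/
theorem IsWellPointed.nonempty_iso (hH : PreservesIntersections.{w} H)
    (hU : PreservesIntersections.{w} U) {P Q S : PointedCoalgebra H U} (hP : P.IsWellPointed)
    (hQ : Q.IsWellPointed) (m : P ⟶ S) (n : Q ⟶ S) : Nonempty (P ≅ Q) := by
  obtain ⟨R, k, l, hk, hl, -⟩ := exists_intersection_pair hH hU m n
    (mono_of_isSimpleCoalgebra hH hP.isSimpleCoalgebra m.hom)
    (mono_of_isSimpleCoalgebra hH hQ.isSimpleCoalgebra n.hom)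
  have := hP.2 k hk
  have := hQ.2 l hl
  exact ⟨(asIso k).symm ≪≫ asIso l⟩

end PointedCoalgebra

/-! ### Essentially small classes of coalgebras -/

section Small

variable {C : Type u} [Category.{w} C] {H : C ⥤ C} {U : C ⥤ Type w}

theorem essentiallySmall_coalgebra (P : ObjectProperty (Endofunctor.Coalgebra H))
    (Q : ObjectProperty C) [ObjectProperty.EssentiallySmall.{w} Q] (h : ∀ A, P A → Q A.V) :
    ObjectProperty.EssentiallySmall.{w} P := by
  obtain ⟨Q', hQ', hQ⟩ := ObjectProperty.EssentiallySmall.exists_small_le'.{w} Q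
  refine ⟨.ofObj (fun t : Σ Y : Subtype Q', (Y.1 ⟶ H.obj Y.1) =>
    (⟨t.1.1, t.2⟩ : Endofunctor.Coalgebra H)), inferInstance, fun A hA => ?_⟩
  obtain ⟨Y, hY, ⟨i⟩⟩ := hQ _ (h A hA)
  exact ⟨_, ⟨⟨⟨Y, hY⟩, i.inv ≫ A.str ≫ H.map i.hom⟩⟩, ⟨Endofunctor.Coalgebra.isoMk i⟩⟩

theorem essentiallySmall_pointedCoalgebra (P : ObjectProperty (PointedCoalgebra H U))
    (Q : ObjectProperty C) [ObjectProperty.EssentiallySmall.{w} Q] (h : ∀ A, P A → Q A.coalg.V) :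
    ObjectProperty.EssentiallySmall.{w} P := by
  obtain ⟨Q', hQ', hQ⟩ := ObjectProperty.EssentiallySmall.exists_small_le'.{w} Q
  refine ⟨.ofObj (fun t : Σ Y : Subtype Q', (Y.1 ⟶ H.obj Y.1) × U.obj Y.1 =>
    (⟨⟨t.1.1, t.2.1⟩, t.2.2⟩ : PointedCoalgebra H U)), inferInstance, fun A hA => ?_⟩
  obtain ⟨Y, hY, ⟨i⟩⟩ := hQ _ (h A hA)
  refine ⟨_, ⟨⟨⟨Y, hY⟩, i.inv ≫ A.coalg.str ≫ H.map i.hom, U.map i.hom A.pt⟩⟩, ?_⟩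
  let f : A ⟶ ⟨⟨Y, i.inv ≫ A.coalg.str ≫ H.map i.hom⟩, U.map i.hom A.pt⟩ :=
    ⟨⟨i.hom, by simp⟩, rfl⟩
  have : IsIso f.hom.f := inferInstanceAs (IsIso i.hom)
  have := PointedCoalgebra.isIso_of_isIso_f f
  exact ⟨asIso f⟩

/-- For a fibre-small, transportable functor to sets, the objects whose underlying sets embed into
a given set form an essentially small class. -/
theorem essentiallySmall_of_injective (hUf : IsFibreSmall U) (hUt : IsUniquelyTransportable U)
    (I : Type w) : ObjectProperty.EssentiallySmall.{w}
      (fun A : C => ∃ f : U.obj A → I, Function.Injective f) := by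
  -- Transport replaces `U A` by the range of its embedding, and `I` has only a set of subsets.
  let Q : ObjectProperty C := ⨆ X : Set I, fun A : C => U.obj A = X
  have (X : Set I) : ObjectProperty.EssentiallySmall.{w} (fun A : C => U.obj A = X) := hUf X
  have : ObjectProperty.EssentiallySmall.{w} Q := inferInstance
  refine ObjectProperty.EssentiallySmall.of_le (Q := Q.isoClosure) ?_
  rintro A ⟨f, hf⟩
  obtain ⟨B, ⟨hB, i, -⟩, -⟩ := hUt A (Set.range f) (Equiv.ofInjective f hf)
  exact ⟨B, by simpa [Q] using ⟨_, hB⟩, ⟨i⟩⟩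

end Small

/-! ### The terminal well-founded coalgebra -/

section Terminal

variable {C : Type u} [Category.{w} C] [IsLocallyFinitelyPresentable.{w} C] {H : C ⥤ C}
  {U : C ⥤ Type w}

/-- If there is, up to isomorphism, only a set of simple well-founded coalgebras, then there is a
terminal well-founded coalgebra. -/
theorem exists_terminal_wellFounded (hH : PreservesIntersections.{w} H)
    (hs : ObjectProperty.EssentiallySmall.{w} (fun A : Endofunctor.Coalgebra H =>
      IsSimpleCoalgebra A ∧ IsWellFoundedCoalgebra A)) :
    ∃ T : Endofunctor.Coalgebra H, IsSimpleCoalgebra T ∧ IsWellFoundedCoalgebra T ∧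
      ∀ A : Endofunctor.Coalgebra H, IsWellFoundedCoalgebra A → Nonempty (A ⟶ T) := by
  obtain ⟨Q, hQ, hle, hle'⟩ := ObjectProperty.EssentiallySmall.exists_small_le.{w}
    (fun A : Endofunctor.Coalgebra H => IsSimpleCoalgebra A ∧ IsWellFoundedCoalgebra A)
  let A : Shrink.{w} (Subtype Q) → Endofunctor.Coalgebra H := fun j => ((equivShrink _).symm j).1
  have : HasColimitsOfShape (Discrete (Shrink.{w} (Subtype Q))) (Endofunctor.Coalgebra H) :=
    hasColimitsOfShape_coalgebra _
  have h₀ : IsWellFoundedCoalgebra (∐ A) := by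
    refine isWellFoundedCoalgebra_of_cover hH (Sigma.ι A)
      (fun j => (hle _ ((equivShrink (Subtype Q)).symm j).2).2) fun M m hm h => ?_
    exact isIso_of_isColimit_coalgebra (colimit.isColimit (Discrete.functor A)) m fun j => h j.as
  obtain ⟨T, e, he, hT⟩ := exists_simple_quotient (∐ A)
  refine ⟨T, hT, h₀.of_strongEpi hH e, fun B hB => ?_⟩
  obtain ⟨S, q, hq, hS⟩ := exists_simple_quotient B
  obtain ⟨S', hS', ⟨i⟩⟩ := hle' S ⟨hS, hB.of_strongEpi hH q⟩
  obtain ⟨j, rfl⟩ : ∃ j, A j = S' := ⟨equivShrink _ ⟨S', hS'⟩, by simp [A]⟩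
  exact ⟨q ≫ i.hom ≫ Sigma.ι A j ≫ e⟩

/-- Lambek's lemma: `H T` is well-founded, so it maps to `T`, and endomorphisms of the simple `T`
are identities. -/
theorem isIso_str_of_terminal (hH : PreservesIntersections.{w} H) {T : Endofunctor.Coalgebra H}
    (hs : IsSimpleCoalgebra T) (hw : IsWellFoundedCoalgebra T)
    (ht : ∀ A : Endofunctor.Coalgebra H, IsWellFoundedCoalgebra A → Nonempty (A ⟶ T)) :
    IsIso T.str := by
  obtain ⟨r⟩ := ht _ (hw.map hH)
  let s : T ⟶ ⟨H.obj T.V, H.map T.str⟩ := ⟨T.str, rfl⟩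
  have h₁ : T.str ≫ r.f = 𝟙 _ :=
    congrArg Endofunctor.Coalgebra.Hom.f (hom_ext_of_isSimpleCoalgebra hs (s ≫ r) (𝟙 T))
  refine ⟨r.f, h₁, ?_⟩
  rw [← r.h]
  change H.map T.str ≫ H.map r.f = _
  rw [← H.map_comp, h₁, H.map_id]

/-- For invertible structure, algebra homomorphisms out of the inverse are exactly the solutions. -/
theorem nonempty_isInitial_of_wellFounded (hH : PreservesIntersections.{w} H) {Z : C}
    (hZ : IsInitial Z) (hZs : IsSimpleObject Z) {T : Endofunctor.Coalgebra H}
    (hw : IsWellFoundedCoalgebra T) [IsIso T.str] :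
    Nonempty (IsInitial (⟨T.V, inv T.str⟩ : Endofunctor.Algebra H)) := by
  have h := hw.existsUnique_isSolution hH hZ hZs
  choose f hf hu using h
  refine ⟨IsInitial.ofUniqueHom (fun B => ⟨f B, ?_⟩) fun B g => Endofunctor.Algebra.ext (hu B _ ?_)⟩
  · change H.map (f B) ≫ B.str = inv T.str ≫ f B
    rw [IsIso.eq_inv_comp]
    exact hf B
  · have h : H.map g.f ≫ B.str = inv T.str ≫ g.f := g.h
    change T.str ≫ H.map g.f ≫ B.str = g.f
    rw [h, IsIso.hom_inv_id_assoc]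

/-- Coalgebra structure can be transported along bijections of the underlying sets. -/
theorem exists_coalgebra_transport {C : Type u} [Category.{w} C] {H : C ⥤ C} {U : C ⥤ Type w}
    (hUt : IsUniquelyTransportable U) (A : Endofunctor.Coalgebra H)
    {I : Type w} (b : U.obj A.V ≃ I) :
    ∃ (T : Endofunctor.Coalgebra H) (hT : U.obj T.V = I) (i : A ≅ T),
      ∀ x, cast hT (U.map i.hom.f x) = b x := by
  obtain ⟨B, ⟨hB, i, hi⟩, -⟩ := hUt A.V I b
  exact ⟨⟨B, i.inv ≫ A.str ≫ H.map i.hom⟩, hB, Endofunctor.Coalgebra.isoMk i, hi⟩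

/-- Well-founded, well-pointed coalgebras form an essentially small class if `H` has an initial
algebra. -/
theorem essentiallySmall_of_hasInitial (hH : PreservesIntersections.{w} H) {Z : C}
    (hZ : IsInitial Z) (hZs : IsSimpleObject Z) [HasInitial (Endofunctor.Algebra H)] :
    ObjectProperty.EssentiallySmall.{w}
      (fun P : PointedCoalgebra H U => P.IsWellFoundedWellPointed) := by
  let B : Endofunctor.Algebra H := ⊥_ _
  have : IsIso B.str := Endofunctor.Algebra.Initial.str_isIso initialIsInitial
  let Q : ObjectProperty C := .ofObj fun N : Subobject B.a => (N : C)
  have : ObjectProperty.EssentiallySmall.{w} Q.isoClosure := inferInstance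
  refine essentiallySmall_pointedCoalgebra _ Q.isoClosure fun P hP => ?_
  obtain ⟨k, hk, -⟩ := hP.1.existsUnique_isSolution hH hZ hZs B
  -- Inverting the structure of the initial algebra turns the solution into a coalgebra
  -- homomorphism, monic because `P` is simple.
  let f : P.coalg ⟶ ⟨B.a, inv B.str⟩ := ⟨k, by
    rw [IsIso.eq_comp_inv, Category.assoc]; exact hk⟩
  have : Mono k := mono_of_isSimpleCoalgebra hH hP.2.isSimpleCoalgebra f
  exact ⟨_, ⟨Subobject.mk k⟩, ⟨(Subobject.underlyingIso k).symm⟩⟩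

/-- Well-pointed modifications of pointed well-founded coalgebras in terms of the terminal
well-founded coalgebra. -/
theorem isWellPointedModification_iff (hH : PreservesIntersections.{w} H)
    (hU : PreservesIntersections.{w} U) {A T : Endofunctor.Coalgebra H}
    (hA : IsWellFoundedCoalgebra A) (hs : IsSimpleCoalgebra T)
    (ht : ∀ A : Endofunctor.Coalgebra H, IsWellFoundedCoalgebra A → Nonempty (A ⟶ T))
    (h : A ⟶ T) (x : U.obj A.V) {Q : PointedCoalgebra H U} (hQ : Q.IsWellPointed) :
    PointedCoalgebra.IsWellPointedModification ⟨A, x⟩ Q ↔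
      Nonempty (Q ⟶ (⟨T, U.map h.f x⟩ : PointedCoalgebra H U)) := by
  constructor
  · rintro ⟨S, e, m, ⟨he, hS⟩, hm, -⟩
    obtain ⟨g⟩ := ht S.coalg (hA.of_strongEpi hH e.hom)
    refine ⟨m ≫ (⟨g, ?_⟩ : S ⟶ _)⟩
    rw [← e.map_pt, ← hom_ext_of_isSimpleCoalgebra hs (e.hom ≫ g) h]
    simp
  · rintro ⟨k⟩
    have hk : Mono k.hom.f := mono_of_isSimpleCoalgebra hH hQ.isSimpleCoalgebra k.hom
    obtain ⟨S, e, n, he, hn, rfl⟩ := exists_coalgebra_factorization hH h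
    let e' : (⟨A, x⟩ : PointedCoalgebra H U) ⟶ ⟨S, U.map e.f x⟩ := ⟨e, rfl⟩
    let n' : (⟨S, U.map e.f x⟩ : PointedCoalgebra H U) ⟶ ⟨T, U.map (e ≫ n).f x⟩ := ⟨n, by simp⟩
    -- As `Q` has no proper subobject, intersecting it with any subobject at the same point returns
    -- `Q`.
    have key {S' : PointedCoalgebra H U} (l : S' ⟶ ⟨T, U.map (e ≫ n).f x⟩) (hl : Mono l.hom.f) :
        ∃ m : Q ⟶ S', m ≫ l = k := by
      obtain ⟨R, p, q, hp, -, hpq⟩ := PointedCoalgebra.exists_intersection_pair hH hU k l hk hl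
      have := hQ.2 p hp
      exact ⟨inv p ≫ q, by rw [Category.assoc, ← hpq, IsIso.inv_hom_id_assoc]⟩
    obtain ⟨m, hm⟩ := key n' hn
    have hm' : Mono (m.hom.f ≫ n.f) := by
      have : (m ≫ n').hom.f = k.hom.f := by rw [hm]
      change Mono (m ≫ n').hom.f
      rwa [this]
    refine ⟨_, e', m, ⟨he, hs.of_mono n⟩, mono_of_mono m.hom.f n.f, fun Q' m' hm' => ?_⟩
    obtain ⟨l, hl⟩ := key (m' ≫ n') (mono_comp m'.hom.f n.f)
    refine ⟨l, PointedCoalgebra.hom_ext ((cancel_mono n.f).1 ?_)⟩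
    have : ((l ≫ m') ≫ n').hom.f = (m ≫ n').hom.f := by rw [hm, ← hl, Category.assoc]
    exact this

end Terminal

/-! ### The canonical coalgebra on a set of representatives -/

section Representatives

variable {C : Type u} [Category.{w} C] {H : C ⥤ C} {U : C ⥤ Type w}

/-- An essentially small class of well-founded, well-pointed coalgebras has a set of
representatives. -/
theorem exists_isSetOfRepresentatives (h : ObjectProperty.EssentiallySmall.{w}
      (fun P : PointedCoalgebra H U => P.IsWellFoundedWellPointed)) :
    ∃ (I : Type w) (R : I → PointedCoalgebra H U), IsSetOfRepresentatives R := by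
  obtain ⟨Q, hQ, hle, hle'⟩ := ObjectProperty.EssentiallySmall.exists_small_le.{w}
    (fun P : PointedCoalgebra H U => P.IsWellFoundedWellPointed)
  let X : Shrink.{w} (Subtype Q) → PointedCoalgebra H U := fun j => ((equivShrink _).symm j).1
  let r : Setoid (Shrink.{w} (Subtype Q)) :=
    { r := fun i j => Nonempty (X i ≅ X j)
      iseqv := ⟨fun _ => ⟨Iso.refl _⟩, fun ⟨i⟩ => ⟨i.symm⟩, fun ⟨i⟩ ⟨j⟩ => ⟨i ≪≫ j⟩⟩ }
  refine ⟨Quotient r, fun q => X q.out, fun q => hle _ ((equivShrink _).symm q.out).2,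
    fun P hP => ?_, fun p q h => ?_⟩
  · obtain ⟨P', hP', ⟨i⟩⟩ := hle' P hP
    obtain ⟨j, rfl⟩ : ∃ j, X j = P' := ⟨equivShrink _ ⟨P', hP'⟩, by simp [X]⟩
    obtain ⟨k⟩ : Nonempty (X (Quotient.mk r j).out ≅ X j) := Quotient.mk_out (s := r) j
    exact ⟨Quotient.mk r j, ⟨i ≪≫ k.symm⟩⟩
  · exact Quotient.out_equiv_out.1 h

variable [IsLocallyFinitelyPresentable.{w} C] {I : Type w} {R : I → PointedCoalgebra H U}

theorem IsSetOfRepresentatives.exists_hom (hR : IsSetOfRepresentatives R)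
    (hH : PreservesIntersections.{w} H) (hU : PreservesIntersections.{w} U) {Z : C}
    (hZ : IsInitial Z) (hZs : IsSimpleObject Z) {S : PointedCoalgebra H U}
    (hS : IsSimpleCoalgebra S.coalg) (hw : IsWellFoundedCoalgebra S.coalg) :
    ∃ i, Nonempty (R i ⟶ S) := by
  obtain ⟨Q, m, hm, hQ⟩ := PointedCoalgebra.exists_isWellPointed hH hU hS
  obtain ⟨i, ⟨e⟩⟩ := hR.exists_iso Q ⟨hw.of_mono hH hZ hZs m.hom, hQ⟩
  exact ⟨i, ⟨e.inv ≫ m⟩⟩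

theorem IsSetOfRepresentatives.eq_of_hom (hR : IsSetOfRepresentatives R)
    (hH : PreservesIntersections.{w} H) (hU : PreservesIntersections.{w} U)
    {S : PointedCoalgebra H U} {i j : I} (f : R i ⟶ S) (g : R j ⟶ S) : i = j :=
  hR.eq_of_iso i j ((hR.mem i).2.nonempty_iso hH hU (hR.mem j).2 f g)

/-- The elements of a simple well-founded coalgebra are classified by representatives. -/
theorem IsSetOfRepresentatives.exists_injective (hR : IsSetOfRepresentatives R)
    (hH : PreservesIntersections.{w} H) (hU : PreservesIntersections.{w} U) {Z : C}
    (hZ : IsInitial Z) (hZs : IsSimpleObject Z) {S : Endofunctor.Coalgebra H}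
    (hS : IsSimpleCoalgebra S) (hw : IsWellFoundedCoalgebra S) :
    ∃ φ : U.obj S.V → I, Function.Injective φ ∧
      ∀ y, Nonempty (R (φ y) ⟶ (⟨S, y⟩ : PointedCoalgebra H U)) := by
  choose φ hφ using fun y => hR.exists_hom hH hU hZ hZs (S := ⟨S, y⟩) hS hw
  refine ⟨φ, fun y y' h => ?_, hφ⟩
  obtain ⟨f⟩ := hφ y
  obtain ⟨g⟩ := hφ y'
  rw [← h] at g
  have hf : U.map f.hom.f (R (φ y)).pt = y := f.map_pt
  have hg : U.map g.hom.f (R (φ y)).pt = y' := g.map_pt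
  -- A representative has at most one homomorphism into the simple `S`, so equal representatives
  -- give equal points.
  rw [← hf, ← hg, hom_ext_of_isSimpleCoalgebra hS f.hom g.hom]

/-- A set of representatives underlies a terminal well-founded coalgebra whose points are
classified by the representatives. -/
theorem IsSetOfRepresentatives.exists_terminal (hR : IsSetOfRepresentatives R)
    (hH : PreservesIntersections.{w} H) (hU : PreservesIntersections.{w} U)
    (hUf : IsFibreSmall U) (hUt : IsUniquelyTransportable U) {Z : C}
    (hZ : IsInitial Z) (hZs : IsSimpleObject Z) :
    ∃ (T : Endofunctor.Coalgebra H) (hT : U.obj T.V = I),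
      IsSimpleCoalgebra T ∧ IsWellFoundedCoalgebra T ∧
      (∀ A : Endofunctor.Coalgebra H, IsWellFoundedCoalgebra A → Nonempty (A ⟶ T)) ∧
      ∀ i y, Nonempty (R i ⟶ (⟨T, y⟩ : PointedCoalgebra H U)) ↔ i = cast hT y := by
  have := essentiallySmall_of_injective hUf hUt I
  obtain ⟨T₀, hs, hw, ht⟩ := exists_terminal_wellFounded hH
    (essentiallySmall_coalgebra _ (fun A : C => ∃ f : U.obj A → I, Function.Injective f)
      fun A hA => by
        obtain ⟨φ, hφ, -⟩ := hR.exists_injective hH hU hZ hZs hA.1 hA.2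
        exact ⟨φ, hφ⟩)
  obtain ⟨φ, hφ, hφR⟩ := hR.exists_injective hH hU hZ hZs hs hw
  -- The point of `R i` goes to a point of `T₀` whose representative must be `R i`.
  have hsurj : Function.Surjective φ := fun i => by
    obtain ⟨k⟩ := ht _ (hR.mem i).1
    obtain ⟨f⟩ := hφR (U.map k.f (R i).pt)
    exact ⟨_, hR.eq_of_hom hH hU f ⟨k, rfl⟩⟩
  obtain ⟨T, hT, i, hi⟩ := exists_coalgebra_transport hUt T₀ (Equiv.ofBijective φ ⟨hφ, hsurj⟩)
  have : Mono i.inv.f := inferInstanceAs (Mono ((Endofunctor.Coalgebra.forget H).map i.inv))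
  refine ⟨T, hT, hs.of_mono i.inv, hw.of_mono hH hZ hZs i.inv,
    fun A hA => (ht A hA).map (· ≫ i.hom), fun j y => ?_⟩
  have hy : U.map i.hom.f (U.map i.inv.f y) = y := by
    rw [← Functor.map_comp_apply, ← Endofunctor.Coalgebra.comp_f, i.inv_hom_id]
    simp
  obtain ⟨f⟩ := hφR (U.map i.inv.f y)
  have hc : cast hT y = φ (U.map i.inv.f y) := by
    rw [← Equiv.ofBijective_apply φ ⟨hφ, hsurj⟩, ← hi, hy]
  let g : R (cast hT y) ⟶ (⟨T, y⟩ : PointedCoalgebra H U) :=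
    eqToHom (congrArg R hc) ≫ f ≫ ⟨i.hom, hy⟩
  refine ⟨fun ⟨f⟩ => hR.eq_of_hom hH hU f g, ?_⟩
  rintro rfl
  exact ⟨g⟩

theorem IsSetOfRepresentatives.exists_isCanonicalCoalgebra [U.Faithful]
    (hR : IsSetOfRepresentatives R)
    (hH : PreservesIntersections.{w} H) (hU : PreservesIntersections.{w} U)
    (hUf : IsFibreSmall U) (hUt : IsUniquelyTransportable U) {Z : C}
    (hZ : IsInitial Z) (hZs : IsSimpleObject Z) :
    ∃ (T : Endofunctor.Coalgebra H) (hT : U.obj T.V = I), IsCanonicalCoalgebra R T hT ∧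
      ∃ _ : IsIso T.str, Nonempty (IsInitial (⟨T.V, inv T.str⟩ : Endofunctor.Algebra H)) := by
  obtain ⟨T, hT, hs, hw, ht, hTR⟩ := hR.exists_terminal hH hU hUf hUt hZ hZs
  have := isIso_str_of_terminal hH hs hw ht
  have hplus {A : Endofunctor.Coalgebra H} (hA : IsWellFoundedCoalgebra A) (h : A ⟶ T) :
      IsPlus R A (fun x => cast hT (U.map h.f x)) := fun x i =>
    (isWellPointedModification_iff hH hU hA hs ht h x (hR.mem i).2).trans (hTR i _)
  refine ⟨T, hT, ⟨fun A hA => ?_, fun i k hk => ?_⟩, this,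
    nonempty_isInitial_of_wellFounded hH hZ hZs hw⟩
  · obtain ⟨h⟩ := ht A hA
    exact ⟨h, hplus hA h⟩
  · obtain ⟨h⟩ := ht _ (hR.mem i).1
    -- Both maps are carried by `a⁺`, so they agree because `U` is faithful.
    have hkh : k = h.f := by
      apply U.map_injective
      ext x
      have h₁ := (hk x _).1 ((hplus (hR.mem i).1 h x _).2 rfl)
      exact ((cast_bijective hT).injective h₁).symm
    subst hkh
    -- The homomorphism `h` sends the point of `R i` to the element `i` itself; the formula for the
    -- structure is then naturality of `h`.
    have hi : i = cast hT (U.map h.f (R i).pt) := (hTR i _).1 ⟨⟨h, rfl⟩⟩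
    have hi' : cast hT.symm i = U.map h.f (R i).pt := by
      rw [cast_eq_iff_heq]
      exact (heq_of_eq hi).trans (cast_heq _ _)
    rw [hi', ← Functor.map_comp_apply, ← Functor.map_comp_apply, h.h]

end Representatives

end WellPointed

theorem mainTheorem4 {C : Type u} [Category.{w} C] [IsLocallyFinitelyPresentable.{w} C]
    (U : C ⥤ Type w) [U.Faithful]
    (hU : WellPointed.PreservesIntersections.{w} U)
    (hUf : WellPointed.IsFibreSmall U)
    (hUt : WellPointed.IsUniquelyTransportable U)
    (Z : C) (hZ : IsInitial Z) (hZs : WellPointed.IsSimpleObject Z)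
    (H : C ⥤ C) (hH : WellPointed.PreservesIntersections.{w} H) :
    (HasInitial (Endofunctor.Algebra H) ↔
      ObjectProperty.EssentiallySmall.{w}
        (fun P : WellPointed.PointedCoalgebra H U => P.IsWellFoundedWellPointed)) ∧
    ∀ (I : Type w) (R : I → WellPointed.PointedCoalgebra H U),
      WellPointed.IsSetOfRepresentatives R →
      ∃ (T : Endofunctor.Coalgebra H) (hT : U.obj T.V = I),
        WellPointed.IsCanonicalCoalgebra R T hT ∧
        ∃ _ : IsIso T.str,
          Nonempty (IsInitial (⟨T.V, inv T.str⟩ : Endofunctor.Algebra H)) := by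
  refine ⟨⟨fun _ => WellPointed.essentiallySmall_of_hasInitial hH hZ hZs, fun h => ?_⟩,
    fun I R hR => hR.exists_isCanonicalCoalgebra hH hU hUf hUt hZ hZs⟩
  obtain ⟨I, R, hR⟩ := WellPointed.exists_isSetOfRepresentatives h
  obtain ⟨T, -, -, _, ⟨hT⟩⟩ := hR.exists_isCanonicalCoalgebra hH hU hUf hUt hZ hZs
  exact hT.hasInitial
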